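/- Let $X=\mathbf{C}^2/\Lambda$ be an abelian surface, where $\Lambda\subset\mathbf{C}^2$ is a lattice, and let $\Gamma$ be a group of holomorphic automorphisms of $X$ (not necessarily fixing the origin). An automorphism $g$ of $X$ is called parabolic if $\|(g^n)^*\|$ grows quadratically with $n$, i.e. $c\,n^2\le\|(g^n)^*\|\le C\,n^2$ for all $n\ge 1$ and some constants $c,C>0$, where $\|\cdot\|$ is any operator norm on $\mathrm{End}(H^2(X;\mathbf{C}))$; such a $g$ preserves a unique genus $1$ fibration $\pi_g\colon X\to B_g$, hence induces an automorphism $g_B$ of the Riemann surface $B_g$ with $\pi_g\circ g=g_B\circ\pi_g$. Assume that - $\Gamma$ is non-elementary: its image in $\mathsf{GL}(H^2(X;\mathbf{Z}))$ contains a non-abelian free group; - $\Gamma$ contains a parabolic element; - for every parabolic element $g$ of $\Gamma$, the automorphism $g_B$ of $B_g$ has infinite order. Let $\mu$ be a $\Gamma$-invariant and ergodic probability measure on (the Borel $\sigma$-algebra of) $X$, where ergodic means that every Borel set $A$ with $g^{-1}(A)=A$ for all $g\in\Gamma$ satisfies $\mu(A)\in\{0,1\}$. Then either $\mu$ is the Haar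 probability measure of $X$, or there are an integer $k\ge 1$, real subtori $S_1,\dots,S_k\subset X$ (closed subgroups that are images of real vector subspaces of $\mathbf{C}^2$) of real dimension $2$, and points $a_1,\dots,a_k\in X$, such that the subsets $a_j+S_j$, $1\le j\le k$, are pairwise distinct and 1. $\bigcup_j (a_j+S_j)$ is $\Gamma$-invariant; 2. $\Gamma$ permutes transitively the subsets $a_j+S_j$, $j=1,\dots,k$; 3. $\mu$ is supported on $\bigcup_j (a_j+S_j)$, and for each $j$ the restriction of $\mu$ to $a_j+S_j$ is $\frac1k m_j$, where $m_j$ is the Haar measure on $a_j+S_j$, i.e. the image of the Haar probability measure of $S_j$ under the translation $s\mapsto a_j+s$. -/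

import Mathlib

open MeasureTheory Topology Filter Set
open scoped Manifold ContDiff ENNReal ComplexConjugate

noncomputable section

namespace AbelianSurface

/-! ## Singular cohomology in degree two -/

section Cohomology

variable (R : Type) [CommRing R] (X : Type) [TopologicalSpace X]

/-- Singular `n`-simplices of `X`: continuous maps from the standard `n`-simplex to `X`. -/
abbrev SingularSimplex (n : ℕ) : Type := C(stdSimplex ℝ (Fin (n + 1)), X)

variable {X} in
/-- The `i`-th face of a singular simplex (restriction to the face opposite to the vertex `i`). -/
def face {n : ℕ} (i : Fin (n + 2)) (σ : SingularSimplex X (n + 1)) : SingularSimplex X n :=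
  σ.comp ⟨stdSimplex.map i.succAbove, stdSimplex.continuous_map i.succAbove⟩

/-- Singular `n`-cochains of `X` with coefficients in `R`. -/
abbrev Cochain (n : ℕ) : Type := SingularSimplex X n → R

/-- The singular coboundary: `(δ φ)(σ) = ∑ i, (-1)^i φ(∂ᵢ σ)`. -/
def coboundary (n : ℕ) : Cochain R X n →ₗ[R] Cochain R X (n + 1) where
  toFun φ σ := ∑ i : Fin (n + 2), (-1 : R) ^ (i : ℕ) * φ (face i σ)
  map_add' φ ψ := by
    ext σ
    simp [mul_add, Finset.sum_add_distrib]
  map_smul' c φ := by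
    ext σ
    simp [Finset.mul_sum, mul_left_comm]

/-- Singular `2`-cocycles. -/
abbrev Cocycle2 : Submodule R (Cochain R X 2) := LinearMap.ker (coboundary R X 2)

/-- `2`-coboundaries, as a submodule of the `2`-cocycles. -/
abbrev Coboundary2 : Submodule R (Cocycle2 R X) :=
  (LinearMap.range (coboundary R X 1)).submoduleOf (Cocycle2 R X)

/-- The second singular cohomology group `H²(X; R)`. -/
abbrev H2 : Type := Cocycle2 R X ⧸ Coboundary2 R X

variable {X}

/-- Pull-back of cochains by a continuous map. -/
def cochainPullback (f : C(X, X)) (n : ℕ) : Cochain R X n →ₗ[R] Cochain R X n where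
  toFun φ σ := φ (f.comp σ)
  map_add' _ _ := rfl
  map_smul' _ _ := rfl

theorem coboundary_cochainPullback (f : C(X, X)) (n : ℕ) (φ : Cochain R X n) :
    coboundary R X n (cochainPullback R f n φ) =
      cochainPullback R f (n + 1) (coboundary R X n φ) := rfl

/-- Pull-back of `2`-cocycles by a continuous map. -/
def cocyclePullback (f : C(X, X)) : Cocycle2 R X →ₗ[R] Cocycle2 R X :=
  (cochainPullback R f 2).restrict fun φ hφ => by
    rw [LinearMap.mem_ker] at hφ ⊢
    rw [coboundary_cochainPullback, hφ, map_zero]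

/-- The pull-back `f^* : H²(X; R) → H²(X; R)`, for `f : X → X` continuous. -/
def pullback (f : C(X, X)) : Module.End R (H2 R X) :=
  Submodule.mapQ (Coboundary2 R X) (Coboundary2 R X) (cocyclePullback R f) (by
    rintro φ ⟨ψ, hψ⟩
    exact ⟨cochainPullback R f 1 ψ, by
      rw [coboundary_cochainPullback, hψ]; rfl⟩)

theorem pullback_id : pullback R (ContinuousMap.id X) = 1 := by
  ext φ; rfl

theorem pullback_comp (f g : C(X, X)) :
    pullback R (f.comp g) = pullback R g * pullback R f := by
  ext φ; rfl

/-- The action of homeomorphisms on `H²(X; R)`, written as a left action: `f` acts by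
`(f⁻¹)^*`. The image of a group of homeomorphisms is the same as with `f ↦ f^*`. -/
def cohomologyAction : (X ≃ₜ X) →* LinearMap.GeneralLinearGroup R (H2 R X) :=
  MonoidHom.toHomUnits
    { toFun := fun f => pullback R (f⁻¹ : X ≃ₜ X)
      map_one' := pullback_id R
      map_mul' := fun f g => by
        rw [← pullback_comp]
        congr 1 }

end Cohomology

/-! ## Complex tori of dimension two and their automorphisms -/

/-- The complex torus `ℂ² / Λ`. -/
abbrev Torus (Λ : Submodule ℤ (ℂ × ℂ)) : Type := (ℂ × ℂ) ⧸ Λ.toAddSubgroup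

variable {Λ : Submodule ℤ (ℂ × ℂ)}

variable (Λ) in
/-- The projection `ℂ² → ℂ² / Λ`. -/
def proj (z : ℂ × ℂ) : Torus Λ := QuotientAddGroup.mk z

variable (Λ) in
/-- The torus `ℂ² / Λ` is an abelian surface: it carries a polarization, i.e. there is a positive
definite Hermitian form on `ℂ²` whose imaginary part is integral on `Λ`. -/
def IsAbelian : Prop :=
  ∃ H : (ℂ × ℂ) →ₗ⋆[ℂ] (ℂ × ℂ) →ₗ[ℂ] ℂ,
    (∀ x y, conj (H x y) = H y x) ∧ (∀ x, x ≠ 0 → 0 < (H x x).re) ∧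
      ∀ x ∈ Λ, ∀ y ∈ Λ, ∃ n : ℤ, (H x y).im = n

/-- A self-map of `ℂ² / Λ` is holomorphic if near every point it is induced by a
holomorphic map between open sets of `ℂ²` (recall that `ℂ² → ℂ² / Λ` is
a local biholomorphism). -/
def IsHolomorphic (f : Torus Λ → Torus Λ) : Prop :=
  ∀ z : ℂ × ℂ, ∃ F : ℂ × ℂ → ℂ × ℂ, AnalyticAt ℂ F z ∧ ∀ᶠ w in 𝓝 z, f (proj Λ w) = proj Λ (F w)

theorem IsHolomorphic.comp {f g : Torus Λ → Torus Λ} (hf : IsHolomorphic f)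
    (hg : IsHolomorphic g) : IsHolomorphic (f ∘ g) := by
  intro z
  obtain ⟨G, hG, hGz⟩ := hg z
  obtain ⟨F, hF, hFz⟩ := hf (G z)
  refine ⟨F ∘ G, hF.comp hG, ?_⟩
  filter_upwards [hGz, hG.continuousAt.eventually hFz] with w h1 h2
  simp only [Function.comp_apply, h1, h2]

theorem isHolomorphic_id : IsHolomorphic (id : Torus Λ → Torus Λ) :=
  fun _ => ⟨id, analyticAt_id, Eventually.of_forall fun _ => rfl⟩

variable (Λ) in
/-- The group `Aut(X)` of biholomorphic transformations of `X = ℂ² / Λ`. -/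
def Aut : Subgroup (Torus Λ ≃ₜ Torus Λ) where
  carrier := {f | IsHolomorphic f ∧ IsHolomorphic f.symm}
  mul_mem' {_ _} hf hg := ⟨hf.1.comp hg.1, hg.2.comp hf.2⟩
  one_mem' := ⟨isHolomorphic_id, isHolomorphic_id⟩
  inv_mem' {_} hf := ⟨hf.2, hf.1⟩

/-! ## Non-elementary groups and parabolic automorphisms -/

/-- `Γ` is non-elementary if its image in `GL(H²(X; ℤ))` contains a non-abelian free group
(equivalently, a free group of rank two). -/
def IsNonElementary (Γ : Subgroup (Torus Λ ≃ₜ Torus Λ)) : Prop :=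
  ∃ φ : FreeGroup (Fin 2) →* LinearMap.GeneralLinearGroup ℤ (H2 ℤ (Torus Λ)),
    Function.Injective φ ∧ φ.range ≤ Γ.map (cohomologyAction ℤ)

/-- `g` is parabolic if `‖(gⁿ)^*‖` grows quadratically with `n`, where `‖·‖` is the operator norm
on `End(H²(X; ℂ))` associated with a norm `p` on `H²(X; ℂ)`. Since this space is finite
dimensional, the choice of `p` is irrelevant. -/
def IsParabolic (g : Torus Λ ≃ₜ Torus Λ) : Prop :=
  ∃ p : Seminorm ℂ (H2 ℂ (Torus Λ)), (∀ v, p v = 0 → v = 0) ∧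
    ∃ c C : ℝ, 0 < c ∧ ∀ n : ℕ, 1 ≤ n →
      (∀ v, p (pullback ℂ (g ^ n : Torus Λ ≃ₜ Torus Λ) v) ≤ C * (n : ℝ) ^ 2 * p v) ∧
      (∃ v, v ≠ 0 ∧
        c * (n : ℝ) ^ 2 * p v ≤ p (pullback ℂ (g ^ n : Torus Λ ≃ₜ Torus Λ) v))

/-- A subset of `ℂ² / Λ` is a smooth curve of genus `1`: it is the image of an elliptic
curve `ℂ / L` by an injective holomorphic immersion (induced by `φ : ℂ → ℂ² / Λ`). -/
def IsGenusOneCurve (E : Set (Torus Λ)) : Prop :=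
  ∃ (L : Submodule ℤ ℂ) (_ : DiscreteTopology L), IsZLattice ℝ L ∧
    ∃ φ : ℂ → Torus Λ,
      (∀ z, ∃ F : ℂ → ℂ × ℂ, AnalyticAt ℂ F z ∧ deriv F z ≠ 0 ∧
        ∀ᶠ w in 𝓝 z, φ w = proj Λ (F w)) ∧
      (∀ z w, φ z = φ w ↔ z - w ∈ L) ∧ range φ = E

/-- `π : X → B` is a genus `1` fibration over the compact Riemann surface `B`: it is holomorphic,
onto, with connected fibers, and all but finitely many fibers are smooth curves of genus `1`. -/
structure IsGenusOneFibration {B : Type} [TopologicalSpace B] [ChartedSpace ℂ B]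
    (π : Torus Λ → B) : Prop where
  holomorphic : MDifferentiable 𝓘(ℂ, ℂ × ℂ) 𝓘(ℂ) fun z : ℂ × ℂ => π (proj Λ z)
  surjective : Function.Surjective π
  connected_fiber : ∀ b, IsConnected (π ⁻¹' {b})
  genus_one : ∃ s : Set B, s.Finite ∧ ∀ b ∉ s, IsGenusOneCurve (π ⁻¹' {b})

/-- `g` acts with infinite order on the base of its invariant genus `1` fibration: whenever
`π : X → B` is a genus `1` fibration such that `π ∘ g = gB ∘ π`, no positive
iterate of `gB` is the identity. (A parabolic automorphism has exactly one invariant genus `1`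
fibration, up to isomorphism of the base, and `gB` is determined by `π` because `π` is onto.) -/
def ActsWithInfiniteOrderOnBase (g : Torus Λ ≃ₜ Torus Λ) : Prop :=
  ∀ (B : Type) [TopologicalSpace B] [T2Space B] [CompactSpace B] [ConnectedSpace B]
    [ChartedSpace ℂ B] [IsManifold 𝓘(ℂ) ω B] (π : Torus Λ → B) (gB : B → B),
    IsGenusOneFibration π → (∀ x, π (g x) = gB (π x)) → ∀ n : ℕ, 1 ≤ n → gB^[n] ≠ id

/-! ## Invariant measures and real subtori -/

/-- `μ` is `Γ`-invariant and ergodic. -/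
structure IsInvariantErgodic (Γ : Subgroup (Torus Λ ≃ₜ Torus Λ)) (μ : Measure (Torus Λ)) :
    Prop where
  invariant : ∀ g ∈ Γ, μ.map g = μ
  ergodic : ∀ A : Set (Torus Λ), MeasurableSet A → (∀ g ∈ Γ, g ⁻¹' A = A) → μ A = 0 ∨ μ Aᶜ = 0

/-- `S` is a real subtorus of real dimension `d` of `ℂ² / Λ`: a closed subgroup that is the
image of a real vector subspace of dimension `d` of `ℂ²`. -/
def IsRealSubtorus (d : ℕ) (S : AddSubgroup (Torus Λ)) : Prop :=
  IsClosed (S : Set (Torus Λ)) ∧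
    ∃ V : Submodule ℝ (ℂ × ℂ), Module.finrank ℝ V = d ∧
      (S : Set (Torus Λ)) = proj Λ '' (V : Set (ℂ × ℂ))

/-- The translate `a + S`. -/
def translate (a : Torus Λ) (S : AddSubgroup (Torus Λ)) : Set (Torus Λ) :=
  (fun s => a + s) '' (S : Set (Torus Λ))

/-- `m` is the Haar measure on `a + S`: the image of the Haar probability measure of `S` by the
translation `s ↦ a + s`. -/
def IsHaarOnTranslate (a : Torus Λ) (S : AddSubgroup (Torus Λ)) (m : Measure (Torus Λ)) : Prop :=
  ∃ ν : Measure S, ν.IsAddHaarMeasure ∧ IsProbabilityMeasure ν ∧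
    m = ν.map fun s : S => a + (s : Torus Λ)

end AbelianSurface

end

namespace AbelianSurface

variable {Λ : Submodule ℤ (ℂ × ℂ)}

/-! ## The projection and affine maps -/

/-! The proof looks at translates of rational subtori of least dimension `d` among those charged by
`μ` (`exists_minimal_translate`). By minimality two distinct such translates meet in a null set
(`aedisjoint_translate`), so by invariance the orbit of a charged one `T = a + S` is finite
(`finite_setOrbit`); by ergodicity it carries `μ`. It remains to show that `μ` is Haar on `T` and
that `d` is 2 or 4.

Automorphisms are affine: the derivative of a lift is periodic, hence constant by Liouville
(`IsHolomorphic.exists_isAffine`). Translations act trivially on `H²` (prism operator), and a form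
`l ∧ conj l` with `l` an eigenform gives a nonzero eigenclass. So quadratic growth of a parabolic
`g` bounds the eigenvalues of its linear part on `Λ` by 1 in modulus; by Kronecker they are roots of
unity, and a power of the linear part is `1 + N` with `N ≠ 0`, `N² = 0`
(`IsParabolic.exists_unipotent`). If every element of `Γ` normalized the line `ℂ N`, the linear
parts would form a metabelian group, against non-elementarity. Conjugation thus gives a second
element with nilpotent part `N'` and `N N' + N' N = c`, `c ≠ 0` (`exists_transversal`).

Powers of these two elements preserve `T`, so `N` and `N'` preserve its direction `V`. Composing a
character `χ` with the `n`-th iterate multiplies it by a phase and by `ψ ^ n`, where `ψ` is the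
character of `l ∘ N`. If `ψ` is not constant on `T`, its level sets there are null by minimality,
and Wiener's lemma kills the Fourier coefficient of `χ`. The remaining characters are trivial along
`N V + N' V = V`. Hence `μ` restricted to `T` is `S`-invariant (`exists_invariance`). Moreover the
range and the kernel of `N` on `V` coincide, so `d` is even.

For `d = 4` the measure is Haar, and for `d = 2` the orbit of `T` is the required family. For `d =
0` a parabolic element has a periodic point; a power of it acts as a translation on the base of its
fibration, and having a fixed point there it is the identity, which the hypothesis forbids
(`not_periodic_of_actsWithInfiniteOrderOnBase`). -/

theorem proj_eq_iff {z w : ℂ × ℂ} : proj Λ z = proj Λ w ↔ z - w ∈ Λ := by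
  rw [proj, proj, eq_comm, QuotientAddGroup.eq, neg_add_eq_sub]
  rfl

theorem proj_add (z w : ℂ × ℂ) : proj Λ (z + w) = proj Λ z + proj Λ w := rfl

theorem proj_sub (z w : ℂ × ℂ) : proj Λ (z - w) = proj Λ z - proj Λ w := rfl

theorem proj_zero : proj Λ 0 = 0 := rfl

theorem proj_eq_zero_iff {z : ℂ × ℂ} : proj Λ z = 0 ↔ z ∈ Λ := by
  rw [← proj_zero, proj_eq_iff, sub_zero]

theorem proj_surjective : Function.Surjective (proj Λ) := QuotientAddGroup.mk_surjective

theorem continuous_proj : Continuous (proj Λ) := continuous_quotient_mk'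

/-- A continuous function with values in a discrete lattice on a neighbourhood of `z` is locally
constant. -/
theorem eventually_eq_of_eventually_mem {M T : Type*} [TopologicalSpace M] [AddCommGroup M]
    {L : Submodule ℤ M} [DiscreteTopology L] [TopologicalSpace T] {f : T → M} {z : T} (hf : ContinuousAt f z) (h : ∀ᶠ w in 𝓝 z, f w ∈ L) :
    ∀ᶠ w in 𝓝 z, f w = f z := by
  have hd : IsDiscrete (L : Set M) := isDiscrete_iff_discreteTopology.2 inferInstance
  obtain ⟨U, hU, hU2⟩ := isDiscrete_iff_forall_mem_exists_isOpen.1 hd (f z) h.self_of_nhds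
  have hz : f z ∈ U := (hU2.symm ▸ mem_singleton (f z) : f z ∈ U ∩ L).1
  filter_upwards [h, hf.eventually (hU.mem_nhds hz)] with w h1 h2
  have : f w ∈ U ∩ L := ⟨h2, h1⟩
  rw [hU2] at this
  exact this

section Discrete

variable [DiscreteTopology Λ]

theorem isCoveringMap_proj : IsCoveringMap (proj Λ) :=
  (AddSubgroup.isAddQuotientCoveringMap Λ.toAddSubgroup
    (isDiscrete_iff_discreteTopology.2 (inferInstanceAs (DiscreteTopology Λ)))).isCoveringMap

instance isClosed_toAddSubgroup : IsClosed (Λ.toAddSubgroup : Set (ℂ × ℂ)) :=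
  haveI : DiscreteTopology Λ.toAddSubgroup := inferInstanceAs (DiscreteTopology Λ)
  AddSubgroup.isClosed_of_discrete

/-- A continuous map from a preconnected space into a lattice is constant. -/
theorem eq_of_forall_mem_of_continuous {T : Type*} [TopologicalSpace T] [PreconnectedSpace T]
    {f : T → ℂ × ℂ} (hf : Continuous f) (h : ∀ t, f t ∈ Λ) (s t : T) : f s = f t := by
  have := PreconnectedSpace.constant (f := fun t => (⟨f t, h t⟩ : Λ)) inferInstance
    (hf.subtype_mk h) (x := s) (y := t)
  exact congrArg Subtype.val this

end Discrete

/-- `f` is induced by the affine map `z ↦ A z + b` of `ℂ²`. -/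
def IsAffine (f : Torus Λ → Torus Λ) (A : Module.End ℂ (ℂ × ℂ)) (b : ℂ × ℂ) : Prop :=
  ∀ z, f (proj Λ z) = proj Λ (A z + b)

theorem isAffine_id : IsAffine (id : Torus Λ → Torus Λ) 1 0 := fun z => by simp

theorem IsAffine.comp {f g : Torus Λ → Torus Λ} {A B : Module.End ℂ (ℂ × ℂ)} {a b : ℂ × ℂ}
    (hf : IsAffine f A a) (hg : IsAffine g B b) : IsAffine (f ∘ g) (A * B) (A b + a) := fun z => by
  simp [hg z, hf (B z + b), add_assoc]

theorem continuous_end (A : Module.End ℂ (ℂ × ℂ)) : Continuous A :=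
  LinearMap.continuous_of_finiteDimensional A

theorem IsAffine.map_mem {f : Torus Λ → Torus Λ} {A : Module.End ℂ (ℂ × ℂ)} {b : ℂ × ℂ}
    (hf : IsAffine f A b) {v : ℂ × ℂ} (hv : v ∈ Λ) : A v ∈ Λ := by
  have h1 := hf v
  have h2 := hf 0
  rw [proj_eq_zero_iff.2 hv, ← proj_zero, h2, proj_eq_iff] at h1
  simpa using Λ.neg_mem h1

section Discrete

variable [DiscreteTopology Λ]

/-- The difference of two affine lifts is continuous with values in `Λ`, hence constant. This is
what makes `linearPart` multiplicative. -/
theorem IsAffine.linear_unique {f : Torus Λ → Torus Λ} {A B : Module.End ℂ (ℂ × ℂ)} {a b : ℂ × ℂ}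
    (hf : IsAffine f A a) (hg : IsAffine f B b) : A = B := by
  have h : ∀ z, (A z + a) - (B z + b) ∈ Λ := fun z => proj_eq_iff.1 ((hf z).symm.trans (hg z))
  have hc : Continuous fun z => (A z + a) - (B z + b) := by
    have := continuous_end A
    have := continuous_end B
    fun_prop
  refine LinearMap.ext fun z => ?_
  have := eq_of_forall_mem_of_continuous hc h z 0
  simp only [map_zero, zero_add] at this
  have h3 : A z - B z = 0 := by
    rw [← sub_eq_zero] at this
    rw [← this]
    abel
  exact sub_eq_zero.1 h3

/-- Near `z`, `F - G - c` takes values in the discrete group `Λ`, so `F` and `G` differ by a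
constant there. -/
theorem eventually_fderiv_eq {F G : ℂ × ℂ → ℂ × ℂ} {z : ℂ × ℂ} {c : ℂ × ℂ}
    (hF : ContinuousAt F z) (hG : ContinuousAt G z)
    (h : ∀ᶠ w in 𝓝 z, proj Λ (F w) = proj Λ (G w) + proj Λ c) :
    fderiv ℂ F z = fderiv ℂ G z := by
  have h1 : ∀ᶠ w in 𝓝 z, F w - G w - c ∈ Λ := by
    filter_upwards [h] with w hw
    rw [← proj_add, proj_eq_iff] at hw
    rwa [sub_sub]
  have h2 := eventually_eq_of_eventually_mem ((hF.sub hG).sub continuousAt_const) h1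
  have h3 : F =ᶠ[𝓝 z] fun w => G w + (F z - G z) := by
    filter_upwards [h2] with w hw
    have : F w - G w = F z - G z := sub_left_injective hw
    rw [← this]; abel
  rw [h3.fderiv_eq]
  simp

/-- The derivatives of the local lifts glue to an entire function `D` on `ℂ²`. It is `Λ`-periodic,
hence bounded because `Λ` is cocompact, hence constant by Liouville. -/
theorem IsHolomorphic.exists_isAffine [IsZLattice ℝ Λ] {f : Torus Λ → Torus Λ}
    (hf : IsHolomorphic f) : ∃ A b, IsAffine f A b := by
  choose F hF hFf using hf
  set D : ℂ × ℂ → (ℂ × ℂ) →L[ℂ] (ℂ × ℂ) := fun z => fderiv ℂ (F z) z with hD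
  have hloc : ∀ z, ∀ᶠ w in 𝓝 z, D w = fderiv ℂ (F z) w := by
    intro z
    filter_upwards [(hF z).eventually_analyticAt, (hFf z).eventually_nhds] with w h1 h2
    refine eventually_fderiv_eq (Λ := Λ) (c := 0) (hF w).continuousAt h1.continuousAt ?_
    filter_upwards [h2, hFf w] with u h3 h4
    rw [← h3, ← h4, proj_zero, add_zero]
  have hdiff : Differentiable ℂ D := fun z =>
    (hF z).fderiv.differentiableAt.congr_of_eventuallyEq (hloc z)
  have hper : ∀ z w, w ∈ Λ → D (z + w) = D z := by
    intro z w hw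
    have hct : ContinuousAt (fun u : ℂ × ℂ => u + w) z := by fun_prop
    have : fderiv ℂ (fun u => F (z + w) (u + w)) z = fderiv ℂ (F z) z := by
      refine eventually_fderiv_eq (Λ := Λ) (c := 0) ?_ (hF z).continuousAt ?_
      · exact ContinuousAt.comp (g := F (z + w)) (hF (z + w)).continuousAt hct
      · filter_upwards [hct.eventually (hFf (z + w)), hFf z] with u h3 h4
        rw [← h3, ← h4, proj_add, proj_eq_zero_iff.2 hw, proj_zero, add_zero, add_zero]
    rw [fderiv_comp_add_right] at this
    exact this
  have hbdd : Bornology.IsBounded (range D) :=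
    (IsZLattice.isCompact_range_of_periodic Λ D hdiff.continuous
      (fun z w hw => hper z w hw)).isBounded
  have hconst : ∀ z, D z = D 0 := fun z => hdiff.apply_eq_apply_of_bounded hbdd z 0
  refine ⟨(D 0 : (ℂ × ℂ) →ₗ[ℂ] (ℂ × ℂ)), F 0 0, ?_⟩
  -- On a ball a local lift minus the linear map `D 0` has zero derivative, so this difference is
  -- locally constant; connectedness of `ℂ²` then makes it constant.
  have hlc : IsLocallyConstant fun z => f (proj Λ z) - proj Λ (D 0 z) := by
    rw [IsLocallyConstant.iff_eventually_eq]
    intro z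
    obtain ⟨r, hr, hball⟩ := Metric.eventually_nhds_iff_ball.1
      ((hloc z).and ((hFf z).and (hF z).eventually_analyticAt))
    filter_upwards [Metric.ball_mem_nhds z hr] with w hw
    rw [(hball w hw).2.1, (hball z (Metric.mem_ball_self hr)).2.1, ← proj_sub, ← proj_sub]
    congr 1
    refine (convex_ball z r).is_const_of_fderivWithin_eq_zero (𝕜 := ℂ)
      (f := fun u => F z u - D 0 u) ?_ ?_ hw (Metric.mem_ball_self hr)
    · exact fun u hu => ((hball u hu).2.2.differentiableAt.sub
        (D 0).differentiableAt).differentiableWithinAt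
    · intro u hu
      rw [fderivWithin_of_isOpen Metric.isOpen_ball hu,
        fderiv_fun_sub (hball u hu).2.2.differentiableAt (D 0).differentiableAt,
        ← (hball u hu).1, hconst, ContinuousLinearMap.fderiv, sub_self]
  intro z
  have h0 := hlc.apply_eq_of_preconnectedSpace z 0
  simp only [map_zero, proj_zero, sub_zero] at h0
  rw [sub_eq_iff_eq_add] at h0
  rw [h0, ← proj_zero, (hFf 0).self_of_nhds, ← proj_add, add_comm]
  rfl

end Discrete

theorem IsAffine.pow {g : Torus Λ ≃ₜ Torus Λ} {A : Module.End ℂ (ℂ × ℂ)} {b : ℂ × ℂ}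
    (hg : IsAffine g A b) (n : ℕ) : ∃ c, IsAffine (g ^ n : Torus Λ ≃ₜ Torus Λ) (A ^ n) c := by
  induction n with
  | zero => exact ⟨0, isAffine_id⟩
  | succ n ih =>
    obtain ⟨c, hc⟩ := ih
    exact ⟨_, hc.comp hg⟩

end AbelianSurface

namespace AbelianSurface

variable {Λ : Submodule ℤ (ℂ × ℂ)}

/-! ## Translations act trivially on the second cohomology group -/

theorem sum_mul_stdSimplex_map {m n : ℕ} (f : Fin m → Fin n) (u : Fin n → ℝ)
    (p : stdSimplex ℝ (Fin m)) : ∑ k, u k * stdSimplex.map f p k = ∑ j, u (f j) * p j := by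
  simp only [stdSimplex.map_coe, FunOnFinite.linearMap_apply_apply, Finset.mul_sum]
  rw [← Finset.sum_fiberwise Finset.univ f fun j => u (f j) * p j]
  refine Finset.sum_congr rfl fun k _ => Finset.sum_congr rfl fun j hj => ?_
  rw [(Finset.mem_filter.1 hj).2]

theorem continuous_stdSimplex_apply {n : ℕ} (k : Fin n) :
    Continuous fun p : stdSimplex ℝ (Fin n) => p k :=
  (continuous_apply k).comp continuous_subtype_val

/-- The singular simplex `p ↦ σ (f_* p) + (∑ k, u k * p k) • t`: a simplex of the prism swept out
by `σ` under the translations by the multiples of `t`. -/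
noncomputable def prism (t : ℂ × ℂ) {m n : ℕ} (σ : SingularSimplex (Torus Λ) n) (f : Fin (m + 1) → Fin (n + 1))
    (u : Fin (m + 1) → Fin 2) : SingularSimplex (Torus Λ) m :=
  ⟨fun p => σ (stdSimplex.map f p) + proj Λ ((∑ k, ((u k : ℕ) : ℝ) * p k) • t), by
    have h1 := stdSimplex.continuous_map (S := ℝ) f
    have h2 : ∀ k, Continuous fun p : stdSimplex ℝ (Fin (m + 1)) => p k :=
      continuous_stdSimplex_apply
    refine (σ.continuous.comp h1).add (continuous_proj.comp ?_)
    exact (continuous_finsetSum _ fun k _ => continuous_const.mul (h2 k)).smul continuous_const⟩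

/-- Taking a face precomposes both vertex functions with the face inclusion. Identifying faces of
prisms thus becomes a decidable equality between functions on finite sets. -/
theorem face_prism (t : ℂ × ℂ) {m n : ℕ} (σ : SingularSimplex (Torus Λ) n)
    {f : Fin (m + 2) → Fin (n + 1)} {u : Fin (m + 2) → Fin 2} {i : Fin (m + 2)}
    (f' : Fin (m + 1) → Fin (n + 1)) (u' : Fin (m + 1) → Fin 2) (hf : f ∘ i.succAbove = f')
    (hu : u ∘ i.succAbove = u') : face i (prism t σ f u) = prism t σ f' u' := by
  subst hf hu
  ext p
  simp only [face, prism, ContinuousMap.comp_apply, ContinuousMap.coe_mk,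
    stdSimplex.map_comp_apply]
  rw [sum_mul_stdSimplex_map i.succAbove fun k => ((u k : ℕ) : ℝ)]
  rfl

theorem prism_face (t : ℂ × ℂ) {m n : ℕ} (σ : SingularSimplex (Torus Λ) (n + 1))
    {f : Fin (m + 1) → Fin (n + 1)} {u : Fin (m + 1) → Fin 2} {i : Fin (n + 2)}
    (f' : Fin (m + 1) → Fin (n + 2)) (hf : i.succAbove ∘ f = f') :
    prism t (face i σ) f u = prism t σ f' u := by
  subst hf
  ext p
  simp only [face, prism, ContinuousMap.comp_apply, ContinuousMap.coe_mk,
    stdSimplex.map_comp_apply]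

/-- The translation by `t`. -/
noncomputable def translation (t : Torus Λ) : C(Torus Λ, Torus Λ) := ⟨fun x => x + t, by fun_prop⟩

theorem prism_bottom (t : ℂ × ℂ) (σ : SingularSimplex (Torus Λ) 2) :
    prism t σ ![0, 1, 2] ![0, 0, 0] = σ := by
  ext p
  have : (![0, 1, 2] : Fin 3 → Fin 3) = id := by decide
  simp [prism, Fin.sum_univ_three, this, proj_zero]

theorem prism_top (t : ℂ × ℂ) (σ : SingularSimplex (Torus Λ) 2) :
    prism t σ ![0, 1, 2] ![1, 1, 1] = (translation (proj Λ t)).comp σ := by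
  ext p
  have h : (![0, 1, 2] : Fin 3 → Fin 3) = id := by decide
  have h1 := stdSimplex.sum_eq_one p
  rw [Fin.sum_univ_three] at h1
  simp [prism, Fin.sum_univ_three, h, translation, h1]

variable (R : Type) [CommRing R]

/-- The cochain on `1`-simplices obtained by evaluating `φ` on the prism. -/
noncomputable def prismCochain (t : ℂ × ℂ) (φ : Cochain R (Torus Λ) 2) : Cochain R (Torus Λ) 1 := fun τ =>
  φ (prism t τ ![0, 0, 1] ![0, 1, 1]) - φ (prism t τ ![0, 1, 1] ![0, 0, 1])

/-- The prism over a triangle is cut into three tetrahedra. The alternating sum of the cocycle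
identities on them cancels the inner walls, leaving the top, the bottom and the lateral faces; the
latter form the coboundary. -/
theorem coboundary_prismCochain (t : ℂ × ℂ) (φ : Cochain R (Torus Λ) 2)
    (hφ : coboundary R (Torus Λ) 2 φ = 0) :
    coboundary R (Torus Λ) 1 (prismCochain R t φ) =
      cochainPullback R (translation (proj Λ t)) 2 φ - φ := by
  ext σ
  have hsum : ∀ τ : SingularSimplex (Torus Λ) 3,
      ∑ i : Fin 4, (-1 : R) ^ (i : ℕ) * φ (face i τ) = 0 := congrFun hφ
  -- The three tetrahedra: the first vector lists vertices of `σ`, the second says whether each lies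
  -- at the bottom (0) or at the top (1).
  have h0 := hsum (prism t σ ![0, 0, 1, 2] ![0, 1, 1, 1])
  have h1 := hsum (prism t σ ![0, 1, 1, 2] ![0, 0, 1, 1])
  have h2 := hsum (prism t σ ![0, 1, 2, 2] ![0, 0, 0, 1])
  rw [Fin.sum_univ_four] at h0 h1 h2
  rw [face_prism t σ ![0, 1, 2] ![1, 1, 1] (by decide) (by decide),
    face_prism t σ ![0, 1, 2] ![0, 1, 1] (by decide) (by decide),
    face_prism t σ ![0, 0, 2] ![0, 1, 1] (by decide) (by decide),
    face_prism t σ ![0, 0, 1] ![0, 1, 1] (by decide) (by decide), prism_top] at h0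
  rw [face_prism t σ ![1, 1, 2] ![0, 1, 1] (by decide) (by decide),
    face_prism t σ ![0, 1, 2] ![0, 1, 1] (by decide) (by decide),
    face_prism t σ ![0, 1, 2] ![0, 0, 1] (by decide) (by decide),
    face_prism t σ ![0, 1, 1] ![0, 0, 1] (by decide) (by decide)] at h1
  rw [face_prism t σ ![1, 2, 2] ![0, 0, 1] (by decide) (by decide),
    face_prism t σ ![0, 2, 2] ![0, 0, 1] (by decide) (by decide),
    face_prism t σ ![0, 1, 2] ![0, 0, 1] (by decide) (by decide),
    face_prism t σ ![0, 1, 2] ![0, 0, 0] (by decide) (by decide), prism_bottom] at h2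
  change ∑ i : Fin 3, (-1 : R) ^ (i : ℕ) * prismCochain R t φ (face i σ) =
    φ ((translation (proj Λ t)).comp σ) - φ σ
  simp only [Fin.sum_univ_three, prismCochain]
  rw [prism_face t σ ![1, 1, 2] (by decide), prism_face t σ ![1, 2, 2] (by decide),
    prism_face t σ ![0, 0, 2] (by decide), prism_face t σ ![0, 2, 2] (by decide),
    prism_face t σ ![0, 0, 1] (by decide), prism_face t σ ![0, 1, 1] (by decide)]
  norm_num at h0 h1 h2 ⊢
  linear_combination -h0 + h1 - h2

/-- Translations act trivially on `H²`. -/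
theorem pullback_translation (t : Torus Λ) : pullback R (translation t) = 1 := by
  obtain ⟨t, rfl⟩ := proj_surjective t
  refine Submodule.linearMap_qext _ (LinearMap.ext fun φ => ?_)
  refine (Submodule.Quotient.eq _).2 ?_
  exact ⟨prismCochain R t φ, coboundary_prismCochain R t (φ : Cochain R (Torus Λ) 2) φ.2⟩

theorem pullback_eq_one_of_isAffine {g : C(Torus Λ, Torus Λ)} {b : ℂ × ℂ} (hg : IsAffine g 1 b) :
    pullback R g = 1 := by
  have : g = translation (proj Λ b) := by
    ext x
    obtain ⟨z, rfl⟩ := proj_surjective x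
    exact hg z
  rw [this, pullback_translation]

end AbelianSurface

namespace AbelianSurface

variable {Λ : Submodule ℤ (ℂ × ℂ)}

/-! ## Cohomology classes of alternating forms -/

/-- `τ` lifts the singular simplex `σ` to `ℂ²`. -/
def IsLift {n : ℕ} (σ : SingularSimplex (Torus Λ) n) (τ : SingularSimplex (ℂ × ℂ) n) : Prop :=
  ∀ p, proj Λ (τ p) = σ p

/-- The affine singular simplex of `ℂ²` with given vertices. -/
noncomputable def affineSimplex {n : ℕ} (x : Fin (n + 1) → ℂ × ℂ) : SingularSimplex (ℂ × ℂ) n :=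
  ⟨fun p => ∑ i, p i • x i,
    continuous_finsetSum _ fun i _ => (continuous_stdSimplex_apply i).smul continuous_const⟩

theorem affineSimplex_vertex {n : ℕ} (x : Fin (n + 1) → ℂ × ℂ) (i : Fin (n + 1)) :
    affineSimplex x (stdSimplex.vertex i) = x i := by
  simp [affineSimplex, Pi.single_apply]

theorem face_affineSimplex {n : ℕ} (x : Fin (n + 2) → ℂ × ℂ) (i : Fin (n + 2)) :
    face i (affineSimplex x) = affineSimplex (x ∘ i.succAbove) := by
  ext1 p
  simp only [face, affineSimplex, ContinuousMap.comp_apply, ContinuousMap.coe_mk,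
    stdSimplex.map_coe, FunOnFinite.linearMap_apply_apply, Finset.sum_smul]
  rw [← Finset.sum_fiberwise Finset.univ i.succAbove fun j => p j • (x ∘ i.succAbove) j]
  refine Finset.sum_congr rfl fun k _ => Finset.sum_congr rfl fun j hj => ?_
  rw [Function.comp_apply, (Finset.mem_filter.1 hj).2]

theorem affineSimplex_add_const {n : ℕ} (x : Fin (n + 1) → ℂ × ℂ) (c : ℂ × ℂ)
    (p : stdSimplex ℝ (Fin (n + 1))) :
    affineSimplex (fun i => x i + c) p = affineSimplex x p + c := by
  simp only [affineSimplex, ContinuousMap.coe_mk, smul_add, Finset.sum_add_distrib,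
    ← Finset.sum_smul, stdSimplex.sum_eq_one, one_smul]

theorem IsLift.face {n : ℕ} {σ : SingularSimplex (Torus Λ) (n + 1)}
    {τ : SingularSimplex (ℂ × ℂ) (n + 1)} (h : IsLift σ τ) (i : Fin (n + 2)) :
    IsLift (AbelianSurface.face i σ) (AbelianSurface.face i τ) := fun _ => h _

instance stdSimplex_preconnectedSpace (n : ℕ) : PreconnectedSpace (stdSimplex ℝ (Fin (n + 1))) :=
  Subtype.preconnectedSpace (convex_stdSimplex ℝ _).isPreconnected

section Discrete

variable [DiscreteTopology Λ]

/-- The simplex contracts to its vertex 0 along segments. The resulting homotopy starts at a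
constant map, which lifts, so homotopy lifting applies; the lift of `σ` is read at time 1. -/
theorem exists_isLift {n : ℕ} (σ : SingularSimplex (Torus Λ) n) : ∃ τ, IsLift σ τ := by
  let v : stdSimplex ℝ (Fin (n + 1)) := stdSimplex.vertex 0
  obtain ⟨z, hz⟩ := proj_surjective (σ v)
  let c : unitInterval × stdSimplex ℝ (Fin (n + 1)) → stdSimplex ℝ (Fin (n + 1)) := fun q =>
    ⟨(1 - (q.1 : ℝ)) • v.1 + (q.1 : ℝ) • q.2.1, convex_stdSimplex ℝ _ v.2 q.2.2
      (sub_nonneg.2 q.1.2.2) q.1.2.1 (by ring)⟩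
  have hc : Continuous c := by
    refine Continuous.subtype_mk ?_ _
    fun_prop
  let H : C(unitInterval × stdSimplex ℝ (Fin (n + 1)), Torus Λ) := ⟨σ ∘ c, σ.continuous.comp hc⟩
  have h0 : ∀ a, H (0, a) = proj Λ ((ContinuousMap.const _ z : C(stdSimplex ℝ (Fin (n + 1)), ℂ × ℂ)) a) := by
    intro a
    have : c (0, a) = v := Subtype.ext (by simp [c])
    change σ (c (0, a)) = _
    rw [this, ← hz]; rfl
  let G := isCoveringMap_proj.liftHomotopy H (ContinuousMap.const _ z) h0
  have hG : proj Λ ∘ G = H := isCoveringMap_proj.liftHomotopy_lifts H _ h0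
  refine ⟨⟨fun p => G (1, p), by fun_prop⟩, fun p => ?_⟩
  have h1 : proj Λ (G (1, p)) = H (1, p) := congrFun hG (1, p)
  have h2 : c (1, p) = p := Subtype.ext (by simp [c])
  change proj Λ (G (1, p)) = σ p
  rw [h1]
  change σ (c (1, p)) = σ p
  rw [h2]

/-- A choice of a lift of a singular simplex. -/
noncomputable def lift {n : ℕ} (σ : SingularSimplex (Torus Λ) n) : SingularSimplex (ℂ × ℂ) n :=
  (exists_isLift σ).choose

theorem isLift_lift {n : ℕ} (σ : SingularSimplex (Torus Λ) n) : IsLift σ (lift σ) :=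
  (exists_isLift σ).choose_spec

/-- Two lifts differ by a constant of `Λ`. Hence `formCochain`, which only sees differences of
vertices, does not depend on the chosen lift. -/
theorem IsLift.sub_eq {n : ℕ} {σ : SingularSimplex (Torus Λ) n} {τ τ' : SingularSimplex (ℂ × ℂ) n}
    (h : IsLift σ τ) (h' : IsLift σ τ') (p q : stdSimplex ℝ (Fin (n + 1))) :
    τ p - τ q = τ' p - τ' q := by
  have := eq_of_forall_mem_of_continuous (τ.continuous.sub τ'.continuous)
    (fun p => proj_eq_iff.1 ((h p).trans (h' p).symm)) p q
  simp only [Pi.sub_apply] at this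
  rw [sub_eq_sub_iff_add_eq_add] at this ⊢
  rw [add_comm (τ' p), ← this, add_comm]

/-- The `2`-cochain given by the integral of (twice) the constant form `B`, computed on the
vertices of a lift. -/
noncomputable def formCochain (B : (ℂ × ℂ) →ₗ[ℝ] (ℂ × ℂ) →ₗ[ℝ] ℂ) : Cochain ℂ (Torus Λ) 2 :=
  fun σ =>
  B (lift σ (stdSimplex.vertex 1) - lift σ (stdSimplex.vertex 0))
    (lift σ (stdSimplex.vertex 2) - lift σ (stdSimplex.vertex 0))

variable (B : (ℂ × ℂ) →ₗ[ℝ] (ℂ × ℂ) →ₗ[ℝ] ℂ)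

theorem formCochain_eq {σ : SingularSimplex (Torus Λ) 2} {τ : SingularSimplex (ℂ × ℂ) 2}
    (h : IsLift σ τ) : formCochain B σ =
      B (τ (stdSimplex.vertex 1) - τ (stdSimplex.vertex 0))
        (τ (stdSimplex.vertex 2) - τ (stdSimplex.vertex 0)) := by
  rw [formCochain, (isLift_lift σ).sub_eq h, (isLift_lift σ).sub_eq h]

theorem formCochain_face {σ : SingularSimplex (Torus Λ) 3} {τ : SingularSimplex (ℂ × ℂ) 3}
    (h : IsLift σ τ) (i : Fin 4) (j : Fin 3 → Fin 4) (hj : i.succAbove = j) :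
    formCochain B (face i σ) =
      B (τ (stdSimplex.vertex (j 1)) - τ (stdSimplex.vertex (j 0)))
        (τ (stdSimplex.vertex (j 2)) - τ (stdSimplex.vertex (j 0))) := by
  subst hj
  have hv : ∀ k : Fin 3, face i τ (stdSimplex.vertex k) = τ (stdSimplex.vertex (i.succAbove k)) :=
    fun k => congrArg τ (stdSimplex.map_vertex _ _)
  rw [formCochain_eq B (h.face i), hv, hv, hv]

-- A lift of a 3-simplex has four vertices in `ℂ²`, and the alternating sum over its faces cancels
-- by bilinearity and antisymmetry alone.
variable {B} in
theorem coboundary_formCochain (hB : ∀ x, B x x = 0) :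
    coboundary ℂ (Torus Λ) 2 (formCochain B) = 0 := by
  have hB2 : ∀ x y, B x y = - B y x := fun x y => by
    have := hB (x + y)
    simp only [map_add, LinearMap.add_apply, hB] at this
    linear_combination this
  ext σ
  change ∑ i : Fin 4, (-1 : ℂ) ^ (i : ℕ) * formCochain B (face i σ) = 0
  obtain ⟨τ, hτ⟩ := exists_isLift σ
  rw [Fin.sum_univ_four, formCochain_face B hτ 0 ![1, 2, 3] (by decide),
    formCochain_face B hτ 1 ![0, 2, 3] (by decide), formCochain_face B hτ 2 ![0, 1, 3] (by decide),
    formCochain_face B hτ 3 ![0, 1, 2] (by decide)]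
  simp only [Matrix.cons_val]
  generalize τ (stdSimplex.vertex (0 : Fin 4)) = a
  generalize τ (stdSimplex.vertex (1 : Fin 4)) = b
  generalize τ (stdSimplex.vertex (2 : Fin 4)) = c
  generalize τ (stdSimplex.vertex (3 : Fin 4)) = d
  simp only [map_sub, LinearMap.sub_apply, hB]
  rw [hB2 c b, hB2 c a, hB2 b a]
  norm_num
  ring

/-- The class in `H²(X; ℂ)` of an alternating form on `ℂ²`. -/
noncomputable def formClass (hB : ∀ x, B x x = 0) : H2 ℂ (Torus Λ) :=
  Submodule.Quotient.mk ⟨formCochain B, coboundary_formCochain hB⟩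

theorem pullback_formClass (hB : ∀ x, B x x = 0) {g : C(Torus Λ, Torus Λ)}
    {A : Module.End ℂ (ℂ × ℂ)} {b : ℂ × ℂ} (hg : IsAffine g A b) {c : ℂ}
    (hc : ∀ x y, B (A x) (A y) = c * B x y) :
    pullback ℂ g (formClass B hB) = c • formClass B hB := by
  refine (congrArg (Submodule.Quotient.mk (p := Coboundary2 ℂ (Torus Λ))) ?_ :
    (Submodule.Quotient.mk (cocyclePullback ℂ g ⟨formCochain B, coboundary_formCochain hB⟩)) =
      Submodule.Quotient.mk (c • ⟨formCochain B, coboundary_formCochain hB⟩))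
  refine Subtype.ext (funext fun σ => ?_)
  change formCochain B (g.comp σ) = c * formCochain B σ
  have hl : IsLift (g.comp σ) ⟨fun p => A (lift σ p) + b,
      ((continuous_end A).comp (lift σ).continuous).add continuous_const⟩ := fun p => by
    change proj Λ (A (lift σ p) + b) = g (σ p)
    rw [← hg, isLift_lift σ p]
  rw [formCochain_eq B hl, formCochain]
  simp only [ContinuousMap.coe_mk, add_sub_add_right_eq_sub, ← map_sub, hc]

/-- The projection to the torus of a singular simplex of `ℂ²`. -/
noncomputable def projSimplex {n : ℕ} (τ : SingularSimplex (ℂ × ℂ) n) : SingularSimplex (Torus Λ) n :=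
  ⟨proj Λ ∘ τ, continuous_proj.comp τ.continuous⟩

omit [DiscreteTopology Λ] in
theorem projSimplex_affineSimplex_eq {n : ℕ} {x y : Fin (n + 1) → ℂ × ℂ} {c : ℂ × ℂ} (hc : c ∈ Λ)
    (h : ∀ i, x i = y i + c) :
    projSimplex (Λ := Λ) (affineSimplex x) = projSimplex (affineSimplex y) := by
  ext p
  change proj Λ (affineSimplex x p) = proj Λ (affineSimplex y p)
  rw [funext h, affineSimplex_add_const, proj_add, proj_eq_zero_iff.2 hc, add_zero]

/-- The parallelogram on `u`, `v` closes up to a 2-cycle in the torus. A primitive `ψ` takes the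
same total on the boundaries of its two triangles, since opposite sides agree modulo `Λ`, whereas
the two values of the cochain differ by `2 B u v`. -/
theorem formClass_ne_zero (hB : ∀ x, B x x = 0) {u v : ℂ × ℂ} (hu : u ∈ Λ) (hv : v ∈ Λ)
    (huv : B u v ≠ 0) : formClass (Λ := Λ) B hB ≠ 0 := by
  intro h0
  obtain ⟨ψ, hψ⟩ := (Submodule.Quotient.mk_eq_zero _).1 h0
  have hψ' : ∀ x : Fin 3 → ℂ × ℂ,
      ψ (projSimplex (affineSimplex (x ∘ (0 : Fin 3).succAbove))) -
      ψ (projSimplex (affineSimplex (x ∘ (1 : Fin 3).succAbove))) +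
      ψ (projSimplex (affineSimplex (x ∘ (2 : Fin 3).succAbove))) =
        B (x 1 - x 0) (x 2 - x 0) := by
    intro x
    have h1 : ∑ i : Fin 3, (-1 : ℂ) ^ (i : ℕ) * ψ (face i (projSimplex (affineSimplex x))) =
        formCochain B (projSimplex (affineSimplex x)) := congrFun hψ _
    rw [formCochain_eq B (τ := affineSimplex x) (fun p => rfl)] at h1
    have h2 : ∀ i : Fin 3, face i (projSimplex (Λ := Λ) (affineSimplex x)) =
        projSimplex (affineSimplex (x ∘ i.succAbove)) := fun i => by
      rw [← face_affineSimplex]; rfl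
    simp only [affineSimplex_vertex, h2] at h1
    rw [← h1, Fin.sum_univ_three]
    norm_num
    ring
  have e1 := hψ' ![0, u, u + v]
  have e2 := hψ' ![0, v, u + v]
  have s1 : projSimplex (Λ := Λ) (affineSimplex (![0, u, u + v] ∘ (0 : Fin 3).succAbove)) =
      projSimplex (affineSimplex (![0, v, u + v] ∘ (2 : Fin 3).succAbove)) := by
    refine projSimplex_affineSimplex_eq hu fun i => ?_
    fin_cases i
    · exact (zero_add u).symm
    · exact add_comm u v
  have s2 : projSimplex (Λ := Λ) (affineSimplex (![0, v, u + v] ∘ (0 : Fin 3).succAbove)) =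
      projSimplex (affineSimplex (![0, u, u + v] ∘ (2 : Fin 3).succAbove)) := by
    refine projSimplex_affineSimplex_eq hv fun i => ?_
    fin_cases i
    · exact (zero_add v).symm
    · rfl
  have s3 : (![0, u, u + v] ∘ (1 : Fin 3).succAbove) = (![0, v, u + v] ∘ (1 : Fin 3).succAbove) := by
    funext i
    fin_cases i <;> rfl
  have hB2 : B v u = - B u v := by
    have := hB (u + v)
    simp only [map_add, LinearMap.add_apply, hB] at this
    linear_combination this
  rw [s1, s3] at e1
  rw [s2] at e2
  simp only [Matrix.cons_val, sub_zero, map_add, hB, hB2] at e1 e2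
  apply huv
  linear_combination (e2 - e1) / 2

end Discrete

end AbelianSurface

namespace AbelianSurface

variable {Λ : Submodule ℤ (ℂ × ℂ)}

/-! ## The linear part of a parabolic automorphism -/

theorem le_one_of_forall_pow_le {r C : ℝ} (h : ∀ n : ℕ, 1 ≤ n → r ^ n ≤ C * (n : ℝ) ^ 2) :
    r ≤ 1 := by
  by_contra! hr
  have h1 := tendsto_pow_const_div_const_pow_of_one_lt 2 hr
  have h2 := (h1.const_mul C).eventually_lt_const (u := 1) (by simp)
  obtain ⟨n, hn1, hn2⟩ := (h2.and (eventually_ge_atTop 1)).exists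
  have h3 : 0 < r ^ n := pow_pos (by linarith) n
  rw [← mul_div_assoc, div_lt_one h3] at hn1
  exact absurd (h n hn2) (not_le.2 hn1)

section Discrete

variable [DiscreteTopology Λ]

-- If `A ^ k = 1`, the iterates of `g ^ k` are translations and act trivially on `H²`, against the
-- lower growth bound.
omit [DiscreteTopology Λ] in
theorem IsParabolic.linear_pow_ne_one {g : Torus Λ ≃ₜ Torus Λ} (hg : IsParabolic g)
    {A : Module.End ℂ (ℂ × ℂ)} {b : ℂ × ℂ} (hA : IsAffine g A b) {k : ℕ} (hk : 1 ≤ k) :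
    A ^ k ≠ 1 := by
  intro h1
  obtain ⟨p, hp, c, C, hc, hgrow⟩ := hg
  obtain ⟨n, hn⟩ := exists_nat_gt (1 / c)
  have hn0 : 1 ≤ n := by
    rcases Nat.eq_zero_or_pos n with rfl | h
    · have := one_div_pos.2 hc
      norm_num at hn
      linarith
    · exact h
  have hm : 1 ≤ k * n := Nat.mul_pos hk hn0
  obtain ⟨d, hd⟩ := hA.pow (k * n)
  rw [pow_mul A, h1, one_pow] at hd
  obtain ⟨v, hv, hle⟩ := (hgrow (k * n) hm).2
  have e := pullback_eq_one_of_isAffine ℂ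
    (g := ((g ^ (k * n) : Torus Λ ≃ₜ Torus Λ) : C(Torus Λ, Torus Λ))) hd
  rw [e, Module.End.one_apply] at hle
  have hpv : 0 < p v := lt_of_le_of_ne (apply_nonneg p v) fun h => hv (hp v h.symm)
  have h2 : c * ((k * n : ℕ) : ℝ) ^ 2 ≤ 1 := by
    by_contra! h
    nlinarith
  have h3 : (n : ℝ) ≤ ((k * n : ℕ) : ℝ) ^ 2 := by
    exact_mod_cast ((Nat.le_mul_of_pos_left n hk).trans (Nat.le_self_pow two_ne_zero _) :
      n ≤ (k * n) ^ 2)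
  rw [div_lt_iff₀ hc] at hn
  nlinarith

variable [IsZLattice ℝ Λ]

/-- The restriction to the lattice of the linear part of an affine map. -/
def latticeMap (A : Module.End ℂ (ℂ × ℂ)) (hA : ∀ v ∈ Λ, A v ∈ Λ) : Module.End ℤ Λ :=
  (A.restrictScalars ℤ).restrict hA

instance : Module.Finite ℤ Λ := ZLattice.module_finite ℝ Λ

instance : Module.Free ℤ Λ := ZLattice.module_free ℝ Λ

/-- A complex root of the characteristic polynomial of `A` on the lattice is an eigenvalue of `A`
acting on real linear forms. -/
theorem exists_form_of_isRoot (A : Module.End ℂ (ℂ × ℂ)) (hA : ∀ v ∈ Λ, A v ∈ Λ) {x : ℂ}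
    (hx : ((latticeMap A hA).charpoly.map (Int.castRingHom ℂ)).IsRoot x) :
    ∃ l : (ℂ × ℂ) →ₗ[ℝ] ℂ, l ≠ 0 ∧ ∀ z, l (A z) = x * l z := by
  classical
  let b := Module.Free.chooseBasis ℤ Λ
  let β := b.ofZLatticeBasis ℝ Λ
  set M := LinearMap.toMatrix b b (latticeMap A hA) with hM
  rw [← LinearMap.charpoly_toMatrix _ b, ← Matrix.charpoly_map, Polynomial.IsRoot,
    Matrix.eval_charpoly] at hx
  -- A left eigenvector is wanted: its entries are the values of the form on the lattice basis.
  obtain ⟨v, hv, hv2⟩ := Matrix.exists_vecMul_eq_zero_iff.2 hx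
  rw [Matrix.vecMul_sub, sub_eq_zero] at hv2
  refine ⟨β.constr ℝ v, fun h => hv (funext fun i => ?_), fun z => ?_⟩
  · have := congrArg (fun l => l (β i)) h
    simpa using this
  · have h : (β.constr ℝ v) ∘ₗ (A.restrictScalars ℝ) = x • (β.constr ℝ v) := by
      refine β.ext fun j => ?_
      have h1 : A (β j) = ∑ i, (M i j : ℝ) • β i := by
        have := b.sum_repr (latticeMap A hA (b j))
        have h2 := congrArg (Λ.subtype) this
        simp only [map_sum, map_zsmul] at h2
        rw [show A (β j) = Λ.subtype (latticeMap A hA (b j)) by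
          simp only [β, Module.Basis.ofZLatticeBasis_apply]; rfl, ← h2]
        refine Finset.sum_congr rfl fun i _ => ?_
        rw [hM, LinearMap.toMatrix_apply]
        simp only [β, Module.Basis.ofZLatticeBasis_apply, Int.cast_smul_eq_zsmul]
        rfl
      have h3 := congrFun hv2 j
      simp only [LinearMap.comp_apply, LinearMap.coe_restrictScalars, h1, map_sum, map_smul,
        Module.Basis.constr_basis, LinearMap.smul_apply, smul_eq_mul]
      simp only [Matrix.vecMul, dotProduct, Matrix.scalar_apply, Matrix.diagonal_apply, mul_ite,
        mul_zero, Finset.sum_ite_eq', Finset.mem_univ, if_true, Matrix.map_apply] at h3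
      rw [mul_comm x, h3]
      refine Finset.sum_congr rfl fun i _ => ?_
      simp [hM, mul_comm]
    exact congrArg (fun l => l z) h

/-- A real linear form which is an eigenvector may be chosen `ℂ`-linear or `ℂ`-antilinear. -/
theorem exists_semilinear_form {A : Module.End ℂ (ℂ × ℂ)} {x : ℂ} {l : (ℂ × ℂ) →ₗ[ℝ] ℂ}
    (hl : l ≠ 0) (hlA : ∀ z, l (A z) = x * l z) :
    ∃ (l' : (ℂ × ℂ) →ₗ[ℝ] ℂ) (e : ℝ), e ≠ 0 ∧ l' ≠ 0 ∧ (∀ z, l' (A z) = x * l' z) ∧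
      ∀ z, l' (Complex.I • z) = e * Complex.I * l' z := by
  let J : (ℂ × ℂ) →ₗ[ℝ] ℂ × ℂ :=
    ((Complex.I • (1 : Module.End ℂ (ℂ × ℂ))) : (ℂ × ℂ) →ₗ[ℂ] ℂ × ℂ).restrictScalars ℝ
  have hJ : ∀ z, J z = Complex.I • z := fun z => rfl
  have hII : ∀ z : ℂ × ℂ, Complex.I • Complex.I • z = -z := fun z => by
    rw [smul_smul, Complex.I_mul_I, neg_one_smul]
  -- Up to a factor 2, `l - i l(i ·)` and `l + i l(i ·)` are the `ℂ`-linear and antilinear parts of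
  -- `l`; both are eigenforms for `A`, and one of them is nonzero.
  by_cases h : l - Complex.I • (l ∘ₗ J) = 0
  · refine ⟨l + Complex.I • (l ∘ₗ J), -1, by norm_num, fun h2 => hl ?_, fun z => ?_, fun z => ?_⟩
    · have : (2 : ℝ) • l = 0 := calc
        (2 : ℝ) • l = (l - Complex.I • (l ∘ₗ J)) + (l + Complex.I • (l ∘ₗ J)) := by
          rw [two_smul]; abel
        _ = 0 := by rw [h, h2, add_zero]
      exact (smul_eq_zero.1 this).resolve_left (by norm_num)
    · simp only [LinearMap.add_apply, LinearMap.smul_apply, LinearMap.comp_apply, hJ, hlA,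
        smul_eq_mul, ← map_smul]
      ring
    · simp only [LinearMap.add_apply, LinearMap.smul_apply, LinearMap.comp_apply, hJ, hII,
        smul_eq_mul, map_neg]
      push_cast
      linear_combination (l (Complex.I • z)) * Complex.I_mul_I
  · refine ⟨l - Complex.I • (l ∘ₗ J), 1, by norm_num, h, fun z => ?_, fun z => ?_⟩
    · simp only [LinearMap.sub_apply, LinearMap.smul_apply, LinearMap.comp_apply, hJ, hlA,
        smul_eq_mul, ← map_smul]
      ring
    · simp only [LinearMap.sub_apply, LinearMap.smul_apply, LinearMap.comp_apply, hJ, hII,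
        smul_eq_mul, map_neg]
      push_cast
      linear_combination (l (Complex.I • z)) * Complex.I_mul_I

/-- The alternating form `l ∧ conj l`. -/
noncomputable def wedgeConj (l : (ℂ × ℂ) →ₗ[ℝ] ℂ) : (ℂ × ℂ) →ₗ[ℝ] (ℂ × ℂ) →ₗ[ℝ] ℂ :=
  LinearMap.mk₂ ℝ (fun u v => l u * conj (l v) - l v * conj (l u))
    (fun u u' v => by simp only [map_add]; ring)
    (fun c u v => by simp only [map_smul, Complex.real_smul, map_mul, Complex.conj_ofReal]; ring)
    (fun u v v' => by simp only [map_add]; ring)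
    (fun c u v => by simp only [map_smul, Complex.real_smul, map_mul, Complex.conj_ofReal]; ring)

theorem exists_mem_ne_zero {B : (ℂ × ℂ) →ₗ[ℝ] (ℂ × ℂ) →ₗ[ℝ] ℂ} (hB : B ≠ 0) :
    ∃ u ∈ Λ, ∃ v ∈ Λ, B u v ≠ 0 := by
  by_contra! h
  refine hB (LinearMap.ext_on (IsZLattice.span_top (K := ℝ) (L := Λ)) fun u hu => ?_)
  exact LinearMap.ext_on (IsZLattice.span_top (K := ℝ) (L := Λ)) fun v hv => h u hu v hv

/-- The class of `wedgeConj l` is a nonzero eigenvector of `(gⁿ)^*` with eigenvalue `‖x‖ ^ (2 * n)`,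
and exponential growth would violate the quadratic upper bound. -/
theorem IsParabolic.norm_root_le_one {g : Torus Λ ≃ₜ Torus Λ} (hg : IsParabolic g)
    {A : Module.End ℂ (ℂ × ℂ)} {b : ℂ × ℂ} (hA : IsAffine g A b) {x : ℂ}
    (hx : ((latticeMap A fun _ => hA.map_mem).charpoly.map (Int.castRingHom ℂ)).IsRoot x) :
    ‖x‖ ≤ 1 := by
  obtain ⟨l₀, hl₀, hl₀A⟩ := exists_form_of_isRoot A _ hx
  obtain ⟨l, e, he, hl, hlA, hlI⟩ := exists_semilinear_form hl₀ hl₀A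
  have hB : ∀ u, wedgeConj l u u = 0 := fun u => sub_self _
  have hBn : ∀ n : ℕ, ∀ u v, wedgeConj l ((A ^ n) u) ((A ^ n) v) =
      (x * conj x) ^ n * wedgeConj l u v := by
    intro n
    have hln : ∀ u, l ((A ^ n) u) = x ^ n * l u := by
      induction n with
      | zero => simp
      | succ n ih => intro u; rw [pow_succ', Module.End.mul_apply, hlA, ih]; ring
    intro u v
    simp only [wedgeConj, LinearMap.mk₂_apply, hln, map_mul, map_pow]
    ring
  -- Semilinearity of `l` enters here: at `(z, i z)` the form equals `-2 e i |l z|²`.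
  have hB0 : wedgeConj l ≠ 0 := by
    intro h0
    refine hl (LinearMap.ext fun z => ?_)
    have h1 : wedgeConj l z (Complex.I • z) = 0 := by rw [h0]; rfl
    simp only [wedgeConj, LinearMap.mk₂_apply, hlI, map_mul, Complex.conj_ofReal,
      Complex.conj_I] at h1
    have h2 : (-2 * e * Complex.I) * (l z * conj (l z)) = 0 := by linear_combination h1
    have h3 := (mul_eq_zero.1 h2).resolve_left (by simp [he])
    rw [Complex.mul_conj, Complex.ofReal_eq_zero, Complex.normSq_eq_zero] at h3
    exact h3
  obtain ⟨u, hu, v, hv, huv⟩ := exists_mem_ne_zero (Λ := Λ) hB0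
  have hcl := formClass_ne_zero (wedgeConj l) hB hu hv huv
  obtain ⟨p, hp, c, C, hc, hgrow⟩ := hg
  have hpv : 0 < p (formClass (wedgeConj l) hB) :=
    lt_of_le_of_ne (apply_nonneg p _) fun h => hcl (hp _ h.symm)
  have hle : ‖x * conj x‖ ≤ 1 := by
    refine le_one_of_forall_pow_le (C := C) fun n hn => ?_
    obtain ⟨d, hd⟩ := hA.pow n
    have h1 := (hgrow n hn).1 (formClass (wedgeConj l) hB)
    rw [pullback_formClass (g := ((g ^ n : Torus Λ ≃ₜ Torus Λ) : C(Torus Λ, Torus Λ)))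
      (wedgeConj l) hB hd (hBn n), map_smul_eq_mul, norm_pow] at h1
    exact le_of_mul_le_mul_right h1 hpv
  rw [norm_mul, Complex.norm_conj] at hle
  nlinarith [norm_nonneg x]

theorem isNilpotent_of_latticeMap {A : Module.End ℂ (ℂ × ℂ)} {hA : ∀ v ∈ Λ, A v ∈ Λ} {k n : ℕ}
    (h : (latticeMap A hA ^ k - 1) ^ n = 0) : (A ^ k - 1) ^ n = 0 := by
  have h1 : ∀ (T : Module.End ℤ Λ) (S : Module.End ℂ (ℂ × ℂ)), (∀ v : Λ, (T v : ℂ × ℂ) = S v) →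
      ∀ m (v : Λ), ((T ^ m) v : ℂ × ℂ) = (S ^ m) v := by
    intro T S hTS m
    induction m with
    | zero => intro v; rfl
    | succ m ih => intro v; rw [pow_succ', pow_succ', Module.End.mul_apply, hTS, ih]; rfl
  have h2 : ∀ v : Λ, ((((latticeMap A hA) ^ k - 1) v : Λ) : ℂ × ℂ) = (A ^ k - 1) v := fun v => by
    rw [LinearMap.sub_apply, LinearMap.sub_apply, ← h1 (latticeMap A hA) A (fun _ => rfl) k v]
    rfl
  have h3 := h1 _ _ h2 n
  rw [h] at h3
  have h4 : (((A ^ k - 1) ^ n : Module.End ℂ (ℂ × ℂ)).restrictScalars ℝ) = 0 :=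
    LinearMap.ext_on (IsZLattice.span_top (K := ℝ) (L := Λ)) fun v hv => (h3 ⟨v, hv⟩).symm
  exact LinearMap.ext fun z => congrArg (fun l => l z) h4

theorem exists_common_exponent (s : Multiset ℂ) (h : ∀ x ∈ s, ∃ n, 0 < n ∧ x ^ n = 1) :
    ∃ k, 0 < k ∧ ∀ x ∈ s, x ^ k = 1 := by
  induction s using Multiset.induction_on with
  | empty => exact ⟨1, one_pos, by simp⟩
  | cons a s ih =>
    obtain ⟨k, hk, hk2⟩ := ih fun x hx => h x (Multiset.mem_cons_of_mem hx)
    obtain ⟨n, hn, hn2⟩ := h a (Multiset.mem_cons_self a s)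
    refine ⟨n * k, Nat.mul_pos hn hk, fun x hx => ?_⟩
    rcases Multiset.mem_cons.1 hx with rfl | hx
    · rw [pow_mul, hn2, one_pow]
    · rw [mul_comm, pow_mul, hk2 x hx, one_pow]

/-- Some power of the linear part of a parabolic automorphism is unipotent and non-trivial. -/
theorem IsParabolic.exists_unipotent {g : Torus Λ ≃ₜ Torus Λ} (hg : IsParabolic g)
    {A : Module.End ℂ (ℂ × ℂ)} {b : ℂ × ℂ} (hA : IsAffine g A b) (hAs : Function.Surjective A) :
    ∃ (k : ℕ) (N : Module.End ℂ (ℂ × ℂ)), 1 ≤ k ∧ A ^ k = 1 + N ∧ N * N = 0 ∧ N ≠ 0 := by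
  set P := (latticeMap A fun _ => hA.map_mem).charpoly with hP
  have hmonic : P.Monic := LinearMap.charpoly_monic _
  -- Kronecker's theorem: all roots of the monic integral `P` lie in the closed unit disc, so its
  -- Mahler measure is 1. The root 0 is excluded by surjectivity of `A`.
  have hroot : ∀ x ∈ (P.map (Int.castRingHom ℂ)).roots, ∃ n, 0 < n ∧ x ^ n = 1 := by
    intro x hx
    refine Polynomial.pow_eq_one_of_mahlerMeasure_eq_one (p := P) ?_ ?_ hx
    · rw [Polynomial.mahlerMeasure_eq_leadingCoeff_mul_prod_roots, (hmonic.map _).leadingCoeff,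
        norm_one, one_mul]
      refine Multiset.prod_eq_one fun r hr => ?_
      obtain ⟨y, hy, rfl⟩ := Multiset.mem_map.1 hr
      exact max_eq_left (hg.norm_root_le_one hA (Polynomial.isRoot_of_mem_roots hy))
    · rintro rfl
      obtain ⟨l, hl, hlA⟩ := exists_form_of_isRoot A _ (Polynomial.isRoot_of_mem_roots hx)
      refine hl (LinearMap.ext fun z => ?_)
      obtain ⟨w, rfl⟩ := hAs z
      rw [hlA, zero_mul]; rfl
  obtain ⟨k, hk, hk2⟩ := exists_common_exponent _ hroot
  -- Each linear factor of `P` over `ℂ` divides `X ^ k - 1`; monicity brings the divisibility back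
  -- to `ℤ`, and Cayley–Hamilton on the lattice then makes `A ^ k - 1` nilpotent.
  have hdvd : P ∣ (Polynomial.X ^ k - 1) ^ Multiset.card (P.map (Int.castRingHom ℂ)).roots := by
    rw [← Polynomial.map_dvd_map (Int.castRingHom ℂ) Int.cast_injective hmonic]
    simp only [Polynomial.map_pow, Polynomial.map_sub, Polynomial.map_X, Polynomial.map_one]
    have h1 := Multiset.prod_dvd_prod_of_dvd (S := (P.map (Int.castRingHom ℂ)).roots)
      (fun a => Polynomial.X - Polynomial.C a) (fun _ => Polynomial.X ^ k - 1) fun a ha => by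
        simp [Polynomial.dvd_iff_isRoot, hk2 a ha]
    rw [Multiset.map_const', Multiset.prod_replicate] at h1
    exact (dvd_of_eq ((IsAlgClosed.splits _).eq_prod_roots_of_monic (hmonic.map _))).trans h1
  obtain ⟨Q, hQ⟩ := hdvd
  have h1 : (latticeMap A (fun _ => hA.map_mem) ^ k - 1) ^
      Multiset.card (P.map (Int.castRingHom ℂ)).roots = 0 := by
    have := congrArg (Polynomial.aeval (latticeMap A fun _ => hA.map_mem)) hQ
    rw [map_mul, hP, LinearMap.aeval_self_charpoly, zero_mul] at this
    simpa using this
  have hnil : IsNilpotent (A ^ k - 1) := ⟨_, isNilpotent_of_latticeMap h1⟩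
  refine ⟨k, A ^ k - 1, hk, by abel, ?_, sub_ne_zero.2 (hg.linear_pow_ne_one hA hk)⟩
  have h2 := LinearMap.aeval_self_charpoly (A ^ k - 1)
  rw [hnil.charpoly_eq_X_pow_finrank] at h2
  simpa [pow_two] using h2

end Discrete

end AbelianSurface

namespace AbelianSurface

variable {Λ : Submodule ℤ (ℂ × ℂ)}

/-! ## Nilpotent endomorphisms of the plane -/

theorem exists_entries_of_sq_eq_zero {M : Matrix (Fin 2) (Fin 2) ℂ} (h : M * M = 0) :
    ∃ a b c : ℂ, M = !![a, b; c, -a] ∧ a ^ 2 + b * c = 0 := by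
  have h00 : M 0 0 * M 0 0 + M 0 1 * M 1 0 = 0 := by
    simpa [Matrix.mul_apply, Fin.sum_univ_two] using congrFun (congrFun h 0) 0
  have h01 : M 0 0 * M 0 1 + M 0 1 * M 1 1 = 0 := by
    simpa [Matrix.mul_apply, Fin.sum_univ_two] using congrFun (congrFun h 0) 1
  have h10 : M 1 0 * M 0 0 + M 1 1 * M 1 0 = 0 := by
    simpa [Matrix.mul_apply, Fin.sum_univ_two] using congrFun (congrFun h 1) 0
  have h11 : M 1 0 * M 0 1 + M 1 1 * M 1 1 = 0 := by
    simpa [Matrix.mul_apply, Fin.sum_univ_two] using congrFun (congrFun h 1) 1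
  have hd : M 1 1 = - M 0 0 := by
    by_contra hne
    have hs : M 0 0 + M 1 1 ≠ 0 := fun h => hne (by linear_combination h)
    have hb : M 0 1 = 0 := (mul_eq_zero.1
      (by linear_combination h01 : M 0 1 * (M 0 0 + M 1 1) = 0)).resolve_right hs
    have ha : M 0 0 = 0 := by simpa [hb] using h00
    have hd : M 1 1 = 0 := by simpa [hb] using h11
    exact hne (by rw [ha, hd, neg_zero])
  refine ⟨M 0 0, M 0 1, M 1 0, ?_, by linear_combination h00⟩
  rw [← hd]
  exact Matrix.eta_fin_two M

/-- For traceless 2×2 matrices the anticommutator is the scalar `tr (M M')`. This is a nondegenerate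
bilinear form on a 3-dimensional space whose isotropic vectors are the nilpotent matrices, and two
orthogonal isotropic vectors there are proportional. -/
theorem matrix_anticommutator {M M' : Matrix (Fin 2) (Fin 2) ℂ} (h : M * M = 0)
    (h' : M' * M' = 0) (h0 : M ≠ 0) :
    ∃ c : ℂ, M * M' + M' * M = c • 1 ∧ (c = 0 → ∃ d : ℂ, M' = d • M) := by
  obtain ⟨a, b, c, rfl, hM⟩ := exists_entries_of_sq_eq_zero h
  obtain ⟨a', b', c', rfl, hM'⟩ := exists_entries_of_sq_eq_zero h'
  refine ⟨2 * a * a' + b * c' + b' * c, ?_, fun hc => ?_⟩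
  · ext i j
    fin_cases i <;> fin_cases j <;> simp <;> ring
  -- Each 2×2 minor of `(a, b, c)`, `(a', b', c')` has a square lying in the ideal of the three
  -- relations.
  · have e1 : b * c' = b' * c := by
      have : (b * c' - b' * c) ^ 2 = 0 := by
        linear_combination (b * c' + b' * c - 2 * a * a') * hc + 4 * a' ^ 2 * hM - 4 * b * c * hM'
      exact sub_eq_zero.1 (pow_eq_zero_iff two_ne_zero |>.1 this)
    have e2 : a * b' = a' * b := by
      have : (a * b' - a' * b) ^ 2 = 0 := by
        linear_combination b' ^ 2 * hM + b ^ 2 * hM' - b * b' * hc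
      exact sub_eq_zero.1 (pow_eq_zero_iff two_ne_zero |>.1 this)
    have e3 : a * c' = a' * c := by
      have : (a * c' - a' * c) ^ 2 = 0 := by
        linear_combination c' ^ 2 * hM + c ^ 2 * hM' - c * c' * hc
      exact sub_eq_zero.1 (pow_eq_zero_iff two_ne_zero |>.1 this)
    by_cases hb : b = 0
    · by_cases hcz : c = 0
      · exfalso
        have ha : a = 0 := by simpa [hb] using hM
        apply h0
        ext i j
        fin_cases i <;> fin_cases j <;> simp [ha, hb, hcz]
      · refine ⟨c' / c, ?_⟩
        ext i j
        fin_cases i <;> fin_cases j <;> simp <;> field_simp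
        · linear_combination -e3
        · linear_combination -e1
        · linear_combination -e3
    · refine ⟨b' / b, ?_⟩
      ext i j
      fin_cases i <;> fin_cases j <;> simp <;> field_simp
      · linear_combination -e2
      · linear_combination e1
      · linear_combination -e2

theorem anticommutator {N N' : Module.End ℂ (ℂ × ℂ)} (h : N * N = 0) (h' : N' * N' = 0)
    (h0 : N ≠ 0) : ∃ c : ℂ, N * N' + N' * N = c • 1 ∧ (c = 0 → ∃ d : ℂ, N' = d • N) := by
  let e := LinearMap.toMatrixAlgEquiv (Module.Basis.finTwoProd ℂ)
  obtain ⟨c, hc, hc2⟩ := matrix_anticommutator (M := e N) (M' := e N')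
    (by rw [← map_mul, h, map_zero]) (by rw [← map_mul, h', map_zero])
    (fun h => h0 (e.injective (h.trans (map_zero e).symm)))
  refine ⟨c, e.injective ?_, fun h => ?_⟩
  · rw [map_add, map_mul, map_mul, hc, map_smul, map_one]
  · obtain ⟨d, hd⟩ := hc2 h
    exact ⟨d, e.injective (by rw [hd, map_smul])⟩

theorem exists_basis_of_sq_eq_zero {N : Module.End ℂ (ℂ × ℂ)} (h : N * N = 0) (h0 : N ≠ 0) :
    ∃ b : Module.Basis (Fin 2) ℂ (ℂ × ℂ), N (b 0) = b 1 ∧ N (b 1) = 0 := by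
  obtain ⟨u, hu⟩ : ∃ u, N u ≠ 0 := by
    by_contra! hN
    exact h0 (LinearMap.ext hN)
  have hNN : ∀ z, N (N z) = 0 := fun z => congrArg (fun l => l z) h
  have hli : LinearIndependent ℂ ![u, N u] := by
    refine LinearIndependent.pair_iff.2 fun s t hst => ?_
    have h1 := congrArg N hst
    simp only [map_add, map_smul, hNN, smul_zero, add_zero, map_zero] at h1
    have hs : s = 0 := (smul_eq_zero.1 h1).resolve_right hu
    rw [hs, zero_smul, zero_add] at hst
    exact ⟨hs, (smul_eq_zero.1 hst).resolve_right hu⟩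
  refine ⟨basisOfLinearIndependentOfCardEqFinrank hli (by simp), ?_, ?_⟩ <;> simp [hNN]

/-- The centralizer of a non-zero nilpotent endomorphism of the plane. -/
theorem exists_eq_of_commute {N C : Module.End ℂ (ℂ × ℂ)} (h : N * N = 0) (h0 : N ≠ 0)
    (hC : Commute C N) : ∃ x y : ℂ, C = x • 1 + y • N := by
  obtain ⟨b, hb0, hb1⟩ := exists_basis_of_sq_eq_zero h h0
  have hsum := b.sum_repr (C (b 0))
  rw [Fin.sum_univ_two] at hsum
  refine ⟨b.repr (C (b 0)) 0, b.repr (C (b 0)) 1, b.ext fun i => ?_⟩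
  fin_cases i
  · change C (b 0) = b.repr (C (b 0)) 0 • b 0 + b.repr (C (b 0)) 1 • N (b 0)
    rw [hb0, hsum]
  · have h2 : C (N (b 0)) = N (C (b 0)) := congrArg (fun l => l (b 0)) hC.eq
    change C (b 1) = b.repr (C (b 0)) 0 • b 1 + b.repr (C (b 0)) 1 • N (b 1)
    rw [← hb0, h2, ← hsum, map_add, map_smul, map_smul, hsum, hb0, hb1]

/-- The centralizer of `N` is the commutative algebra spanned by `1` and `N`. -/
theorem commute_of_commute_nilpotent {N C D : Module.End ℂ (ℂ × ℂ)} (h : N * N = 0) (h0 : N ≠ 0)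
    (hC : Commute C N) (hD : Commute D N) : Commute C D := by
  obtain ⟨x, y, rfl⟩ := exists_eq_of_commute h h0 hC
  exact ((Commute.one_left D).smul_left x).add_left (hD.symm.smul_left y)

/-- The scaling factor is multiplicative, so `u * v` and `v * u` have the same one and their
quotient has factor 1. With the preceding lemma, the normalizer of the line `ℂ N` is metabelian. -/
theorem commute_commutator_of_scaling {N : Module.End ℂ (ℂ × ℂ)} (h0 : N ≠ 0)
    {u v : (Module.End ℂ (ℂ × ℂ))ˣ} (hu : ∃ c : ℂ, (u : Module.End ℂ (ℂ × ℂ)) * N = c • (N * u))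
    (hv : ∃ c : ℂ, (v : Module.End ℂ (ℂ × ℂ)) * N = c • (N * v)) :
    Commute ((u * v * (v * u)⁻¹ : (Module.End ℂ (ℂ × ℂ))ˣ) : Module.End ℂ (ℂ × ℂ)) N := by
  obtain ⟨c, hc⟩ := hu
  obtain ⟨d, hd⟩ := hv
  have h1 : ((u * v : (Module.End ℂ (ℂ × ℂ))ˣ) : Module.End ℂ (ℂ × ℂ)) * N =
      (c * d) • (N * (u * v : (Module.End ℂ (ℂ × ℂ))ˣ)) := by
    rw [Units.val_mul, mul_assoc, hd, mul_smul_comm, ← mul_assoc, hc, smul_mul_assoc, smul_smul,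
      mul_assoc, mul_comm c d]
  have h2 : ((v * u : (Module.End ℂ (ℂ × ℂ))ˣ) : Module.End ℂ (ℂ × ℂ)) * N =
      (c * d) • (N * (v * u : (Module.End ℂ (ℂ × ℂ))ˣ)) := by
    rw [Units.val_mul, mul_assoc, hc, mul_smul_comm, ← mul_assoc, hd, smul_mul_assoc, smul_smul,
      mul_assoc]
  generalize u * v = w at *
  generalize v * u = w' at *
  have hcd : c * d ≠ 0 := by
    intro h
    rw [h, zero_smul] at h1
    exact h0 ((Units.mul_right_eq_zero w).1 h1)
  have h4 : (c * d) • (((w'⁻¹ : (Module.End ℂ (ℂ × ℂ))ˣ) : Module.End ℂ (ℂ × ℂ)) * N) =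
      N * (w'⁻¹ : (Module.End ℂ (ℂ × ℂ))ˣ) := by
    rw [Units.eq_mul_inv_iff_mul_eq, smul_mul_assoc, mul_assoc, ← mul_smul_comm, ← h2,
      Units.inv_mul_cancel_left]
  change _ = _
  refine smul_right_injective _ hcd ?_
  change (c * d) • (_ * N) = (c * d) • (N * _)
  rw [Units.val_mul, mul_assoc, ← mul_smul_comm, h4, ← mul_assoc, h1, smul_mul_assoc, mul_assoc]

/-! ## Two transversal unipotent elements -/

section Discrete

variable [DiscreteTopology Λ] [IsZLattice ℝ Λ]

variable (Λ) in
/-- The linear part of an automorphism. -/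
noncomputable def linearPart : Aut Λ →* Module.End ℂ (ℂ × ℂ) where
  toFun f := (f.2.1.exists_isAffine).choose
  map_one' := by
    obtain ⟨b, hb⟩ := ((1 : Aut Λ).2.1.exists_isAffine).choose_spec
    exact hb.linear_unique isAffine_id
  map_mul' f g := by
    obtain ⟨a, ha⟩ := (f.2.1.exists_isAffine).choose_spec
    obtain ⟨b, hb⟩ := (g.2.1.exists_isAffine).choose_spec
    obtain ⟨c, hc⟩ := ((f * g).2.1.exists_isAffine).choose_spec
    exact hc.linear_unique (ha.comp hb)

theorem exists_isAffine_linearPart (f : Aut Λ) :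
    ∃ b, IsAffine (f : Torus Λ ≃ₜ Torus Λ) (linearPart Λ f) b :=
  (f.2.1.exists_isAffine).choose_spec

/-- The commutators `⁅x₀, x₁⁆` and `⁅x₀, x₁⁻¹⁆` do not commute in the free group. -/
theorem freeGroup_word_ne_one {x y : FreeGroup (Fin 2)} (hx : x = FreeGroup.of 0)
    (hy : y = FreeGroup.of 1) :
    (x * y * (y * x)⁻¹) * (x * y⁻¹ * (y⁻¹ * x)⁻¹) *
      ((x * y⁻¹ * (y⁻¹ * x)⁻¹) * (x * y * (y * x)⁻¹))⁻¹ ≠ 1 := by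
  subst hx hy
  decide

/-- Otherwise the linear parts form a metabelian group, so a nontrivial word in two free generators
has linear part 1. That word acts by a translation, hence trivially on `H²`, against freeness of the
image. -/
theorem IsNonElementary.exists_not_scaling {Γ : Subgroup (Torus Λ ≃ₜ Torus Λ)}
    (hΓ : IsNonElementary Γ) (hAut : Γ ≤ Aut Λ) {N : Module.End ℂ (ℂ × ℂ)} (h : N * N = 0)
    (h0 : N ≠ 0) : ∃ f : Aut Λ, (f : Torus Λ ≃ₜ Torus Λ) ∈ Γ ∧
      ¬ ∃ c : ℂ, linearPart Λ f * N = c • (N * linearPart Λ f) := by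
  by_contra! hcon
  obtain ⟨φ, hφ, hφΓ⟩ := hΓ
  have hgen : ∀ i, ∃ f ∈ Γ, cohomologyAction ℤ f = φ (FreeGroup.of i) := fun i =>
    hφΓ ⟨_, rfl⟩
  choose f hfΓ hf using hgen
  let ψ : FreeGroup (Fin 2) →* Γ := FreeGroup.lift fun i => ⟨f i, hfΓ i⟩
  have hψ : ∀ w, cohomologyAction ℤ (ψ w : Torus Λ ≃ₜ Torus Λ) = φ w := by
    have : ((cohomologyAction ℤ).comp Γ.subtype).comp ψ = φ := by
      refine FreeGroup.ext_hom _ _ fun i => ?_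
      simp [ψ, hf]
    exact fun w => congrArg (fun l => l w) this
  let ρ : FreeGroup (Fin 2) →* (Module.End ℂ (ℂ × ℂ))ˣ :=
    ((linearPart Λ).comp ((Subgroup.inclusion hAut).comp ψ)).toHomUnits
  have hscal : ∀ w, ∃ c : ℂ, (ρ w : Module.End ℂ (ℂ × ℂ)) * N = c • (N * ρ w) := fun w =>
    hcon _ (ψ w).2
  have hcomm : ∀ x y, ρ ((x * y * (y * x)⁻¹) * (x * y⁻¹ * (y⁻¹ * x)⁻¹) *
      ((x * y⁻¹ * (y⁻¹ * x)⁻¹) * (x * y * (y * x)⁻¹))⁻¹) = 1 := by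
    intro x y
    rw [map_mul, map_inv, mul_inv_eq_one]
    simp only [map_mul, map_inv]
    refine Units.ext ?_
    have hs := hscal y⁻¹
    rw [map_inv] at hs
    exact commute_of_commute_nilpotent h h0 (commute_commutator_of_scaling h0 (hscal x) (hscal y))
      (commute_commutator_of_scaling h0 (hscal x) hs)
  have hρ := hcomm (FreeGroup.of 0) (FreeGroup.of 1)
  refine freeGroup_word_ne_one rfl rfl (hφ ?_)
  generalize (_ * _ * (_ * _)⁻¹ : FreeGroup (Fin 2)) = w at hρ ⊢
  rw [map_one, ← hψ]
  refine Units.ext ?_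
  -- `cohomologyAction` pulls back by the inverse, so the linear part of the inverse word is needed.
  have hw : linearPart Λ (Subgroup.inclusion hAut (ψ w⁻¹)) = 1 := by
    have : ρ w⁻¹ = 1 := by rw [map_inv, hρ, inv_one]
    exact congrArg Units.val this
  obtain ⟨b, hb⟩ := exists_isAffine_linearPart (Subgroup.inclusion hAut (ψ w⁻¹))
  rw [hw, map_inv] at hb
  exact pullback_eq_one_of_isAffine ℤ
    (g := (((ψ w : Torus Λ ≃ₜ Torus Λ)⁻¹ : Torus Λ ≃ₜ Torus Λ) : C(Torus Λ, Torus Λ))) hb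

theorem linearPart_surjective (f : Aut Λ) : Function.Surjective (linearPart Λ f) := fun z =>
  ⟨linearPart Λ f⁻¹ z, by
    rw [← Module.End.mul_apply, ← map_mul, mul_inv_cancel, map_one, Module.End.one_apply]⟩

/-- The pair is a unipotent power of `g` and its conjugate by an `f` that does not normalize `ℂ N`.
The conjugated nilpotent `A N A⁻¹` is then not a multiple of `N`, so the anticommutator is a nonzero
scalar. -/
theorem exists_transversal {Γ : Subgroup (Torus Λ ≃ₜ Torus Λ)} (hΓ : IsNonElementary Γ)
    (hAut : Γ ≤ Aut Λ) {g : Torus Λ ≃ₜ Torus Λ} (hg : g ∈ Γ) (hpar : IsParabolic g) :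
    ∃ (h : Fin 2 → (Torus Λ ≃ₜ Torus Λ)) (N : Fin 2 → Module.End ℂ (ℂ × ℂ)) (b : Fin 2 → ℂ × ℂ)
      (c : ℂ), (∀ i, h i ∈ Γ) ∧ (∀ i, IsAffine (h i) (1 + N i) (b i)) ∧ (∀ i, N i * N i = 0) ∧
      c ≠ 0 ∧ N 0 * N 1 + N 1 * N 0 = c • 1 := by
  obtain ⟨a, ha⟩ := exists_isAffine_linearPart ⟨g, hAut hg⟩
  obtain ⟨k, N, hk, hN, hN2, hN0⟩ := hpar.exists_unipotent ha (linearPart_surjective _)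
  obtain ⟨f, hfΓ, hf⟩ := hΓ.exists_not_scaling hAut hN2 hN0
  obtain ⟨b, hb⟩ := ha.pow k
  rw [hN] at hb
  obtain ⟨d, hd⟩ := exists_isAffine_linearPart f
  obtain ⟨d', hd'⟩ := exists_isAffine_linearPart f⁻¹
  have h1 : linearPart Λ f * linearPart Λ f⁻¹ = 1 := by rw [← map_mul, mul_inv_cancel, map_one]
  have h2 : linearPart Λ f⁻¹ * linearPart Λ f = 1 := by rw [← map_mul, inv_mul_cancel, map_one]
  set A := linearPart Λ f
  set A' := linearPart Λ f⁻¹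
  have hN' : (A * N * A') * (A * N * A') = 0 := calc
    (A * N * A') * (A * N * A') = A * N * (A' * A) * N * A' := by simp only [mul_assoc]
    _ = A * (N * N) * A' := by rw [h2]; simp only [mul_assoc, one_mul]
    _ = 0 := by rw [hN2]; simp
  obtain ⟨c, hc, hc0⟩ := anticommutator hN2 hN' hN0
  refine ⟨![g ^ k, f * g ^ k * f⁻¹], ![N, A * N * A'], ![b, (A * (1 + N)) d' + (A b + d)], c, ?_, ?_, ?_, ?_, hc⟩
  · rw [Fin.forall_fin_two]
    exact ⟨Γ.pow_mem hg k, Γ.mul_mem (Γ.mul_mem hfΓ (Γ.pow_mem hg k)) (Γ.inv_mem hfΓ)⟩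
  · rw [Fin.forall_fin_two]
    refine ⟨hb, ?_⟩
    have := (hd.comp hb).comp hd'
    rw [show A * (1 + N) * A' = 1 + A * N * A' by rw [mul_add, add_mul, mul_one, h1]] at this
    exact this
  · rw [Fin.forall_fin_two]
    exact ⟨hN2, hN'⟩
  · intro h
    obtain ⟨e, he⟩ := hc0 h
    refine hf ⟨e, ?_⟩
    rw [← smul_mul_assoc, ← he, mul_assoc (A * N), h2, mul_one]

end Discrete

end AbelianSurface

namespace AbelianSurface

variable {Λ : Submodule ℤ (ℂ × ℂ)}

/-! ## Characters and Fourier coefficients -/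

variable (Λ) in
/-- The real linear forms on `ℂ²` which are integral on `Λ`. -/
def dualLattice : AddSubgroup ((ℂ × ℂ) →ₗ[ℝ] ℝ) where
  carrier := {l | ∀ v ∈ Λ, ∃ n : ℤ, l v = n}
  zero_mem' := fun _ _ => ⟨0, by simp⟩
  add_mem' {l l'} h h' := fun v hv => by
    obtain ⟨n, hn⟩ := h v hv
    obtain ⟨m, hm⟩ := h' v hv
    exact ⟨n + m, by simp [hn, hm]⟩
  neg_mem' {l} h := fun v hv => by
    obtain ⟨n, hn⟩ := h v hv
    exact ⟨-n, by simp [hn]⟩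

/-- `t ↦ exp (2 π i t)`. -/
noncomputable def expTwoPi (t : ℝ) : ℂ := Complex.exp (2 * Real.pi * Complex.I * t)

theorem expTwoPi_add (s t : ℝ) : expTwoPi (s + t) = expTwoPi s * expTwoPi t := by
  simp only [expTwoPi, ← Complex.exp_add]
  push_cast
  ring_nf

theorem expTwoPi_zero : expTwoPi 0 = 1 := by simp [expTwoPi]

theorem expTwoPi_nat_mul (n : ℕ) (t : ℝ) : expTwoPi (n * t) = expTwoPi t ^ n := by
  simp only [expTwoPi, ← Complex.exp_nat_mul]
  push_cast
  ring_nf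

theorem expTwoPi_eq_one_iff {t : ℝ} : expTwoPi t = 1 ↔ ∃ n : ℤ, t = n := by
  rw [expTwoPi, Complex.exp_eq_one_iff]
  refine exists_congr fun n => ?_
  have h : (2 * Real.pi * Complex.I : ℂ) ≠ 0 := by simp [Real.pi_ne_zero]
  rw [mul_comm, mul_left_inj' h]
  exact_mod_cast Iff.rfl

theorem norm_expTwoPi (t : ℝ) : ‖expTwoPi t‖ = 1 := by
  rw [expTwoPi, show (2 * Real.pi * Complex.I * t : ℂ) = ((2 * Real.pi * t : ℝ) : ℂ) * Complex.I by
    push_cast; ring, Complex.norm_exp_ofReal_mul_I]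

theorem star_expTwoPi (t : ℝ) : star (expTwoPi t) = expTwoPi (-t) := by
  rw [expTwoPi, expTwoPi, Complex.star_def, ← Complex.exp_conj]
  have : conj (2 : ℂ) = 2 := Complex.conj_ofNat 2
  simp [this]

theorem continuous_expTwoPi : Continuous expTwoPi := by
  unfold expTwoPi
  fun_prop

theorem expTwoPi_sub_eq_one_iff {s t : ℝ} : expTwoPi s = expTwoPi t ↔ ∃ n : ℤ, s - t = n := by
  rw [← expTwoPi_eq_one_iff, sub_eq_add_neg, expTwoPi_add]
  have h : expTwoPi t * expTwoPi (-t) = 1 := by rw [← expTwoPi_add, add_neg_cancel, expTwoPi_zero]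
  have h0 : expTwoPi (-t) ≠ 0 := right_ne_zero_of_mul_eq_one h
  rw [← h, mul_left_inj' h0]

/-- The character of the torus associated with a real form which is integral on the lattice. -/
noncomputable def character (l : dualLattice Λ) : C(Torus Λ, ℂ) where
  toFun := Quotient.lift (fun z => expTwoPi (l.1 z)) fun a b hab => by
    have h : a - b ∈ Λ := proj_eq_iff.1 (Quotient.sound hab : proj Λ a = proj Λ b)
    obtain ⟨n, hn⟩ := l.2 _ h
    exact expTwoPi_sub_eq_one_iff.2 ⟨n, by rw [← map_sub, hn]⟩
  continuous_toFun := Continuous.quotient_lift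
    (continuous_expTwoPi.comp (LinearMap.continuous_of_finiteDimensional l.1)) _

theorem character_proj (l : dualLattice Λ) (z : ℂ × ℂ) :
    character l (proj Λ z) = expTwoPi (l.1 z) := rfl

theorem norm_character (l : dualLattice Λ) (x : Torus Λ) : ‖character l x‖ = 1 := by
  obtain ⟨z, rfl⟩ := proj_surjective x
  rw [character_proj, norm_expTwoPi]

theorem character_add_right (l : dualLattice Λ) (x y : Torus Λ) :
    character l (x + y) = character l x * character l y := by
  obtain ⟨z, rfl⟩ := proj_surjective x
  obtain ⟨w, rfl⟩ := proj_surjective y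
  rw [← proj_add, character_proj, character_proj, character_proj, map_add, expTwoPi_add]

/-- Wiener's lemma: a finite complex measure `χ μ` whose Fourier coefficients along `ψ` have
constant modulus vanishes if the level sets of `ψ` are negligible. -/
theorem integral_eq_zero_of_norm_integral_mul_pow {X : Type*} [MeasurableSpace X] {μ : Measure X}
    [IsFiniteMeasure μ] {χ ψ : X → ℂ} (hχ : Measurable χ) (hψ : Measurable ψ)
    (hχ1 : ∀ x, ‖χ x‖ = 1) (hψ1 : ∀ x, ‖ψ x‖ = 1) (hnull : ∀ c, μ {x | ψ x = c} = 0)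
    (h : ∀ n : ℕ, ‖∫ x, χ x * ψ x ^ n ∂μ‖ = ‖∫ x, χ x ∂μ‖) : ∫ x, χ x ∂μ = 0 := by
  set G : ℕ → X × X → ℂ := fun n p =>
    (χ p.1 * ψ p.1 ^ n) * conj (χ p.2 * ψ p.2 ^ n) with hG
  have hGm : ∀ n, Measurable (G n) := fun n => by
    have h1 : Measurable fun x => χ x * ψ x ^ n := hχ.mul (hψ.pow_const n)
    exact (h1.comp measurable_fst).mul
      ((Complex.continuous_conj.measurable.comp h1).comp measurable_snd)
  have hG1 : ∀ n p, ‖G n p‖ = 1 := fun n p => by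
    simp [hG, hχ1, hψ1]
  have hGi : ∀ n, Integrable (G n) (μ.prod μ) := fun n =>
    Integrable.of_bound (hGm n).aestronglyMeasurable 1 (Eventually.of_forall fun p => (hG1 n p).le)
  have hGint : ∀ n, ∫ p, G n p ∂(μ.prod μ) = ((‖∫ x, χ x ∂μ‖ ^ 2 : ℝ) : ℂ) := fun n => by
    rw [hG]
    simp only
    rw [integral_prod_mul (fun x => χ x * ψ x ^ n) (fun x => conj (χ x * ψ x ^ n)), integral_conj,
      Complex.mul_conj, Complex.normSq_eq_norm_sq, h n]
  -- By Fubini the set where `ψ p.1 = ψ p.2` is null, since its slices are level sets of `ψ`.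
  have hae : ∀ᵐ p ∂(μ.prod μ), ψ p.1 * conj (ψ p.2) ≠ 1 := by
    have hms : MeasurableSet {p : X × X | ψ p.1 * conj (ψ p.2) = 1} :=
      measurableSet_eq_fun ((hψ.comp measurable_fst).mul
        ((Complex.continuous_conj.measurable.comp hψ).comp measurable_snd)) measurable_const
    have : (μ.prod μ) {p : X × X | ψ p.1 * conj (ψ p.2) = 1} = 0 := by
      rw [Measure.measure_prod_null hms]
      refine Eventually.of_forall fun x => measure_mono_null (fun y hy => ?_) (hnull (ψ x))
      have hy' : ψ x * conj (ψ y) = 1 := hy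
      have h2 : ψ y * conj (ψ y) = 1 := by
        rw [Complex.mul_conj, Complex.normSq_eq_norm_sq, hψ1]; norm_num
      exact mul_right_cancel₀ (right_ne_zero_of_mul_eq_one h2) (h2.trans hy'.symm)
    simpa [ae_iff] using this
  -- Cesàro means of the `G n`. Almost everywhere they are averages of a geometric progression of
  -- ratio `w ≠ 1`, `‖w‖ = 1`, so they tend to 0, while each has integral `‖∫ χ‖²` as soon as `M ≥
  -- 1`.
  set F : ℕ → X × X → ℂ := fun M p => (M : ℂ)⁻¹ * ∑ n ∈ Finset.range M, G n p with hF
  have hlim : Tendsto (fun M => ∫ p, F M p ∂(μ.prod μ)) atTop (𝓝 (∫ _, (0 : ℂ) ∂(μ.prod μ))) := by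
    refine tendsto_integral_of_dominated_convergence (fun _ => (1 : ℝ)) (fun M => ?_)
      (integrable_const 1) (fun M => Eventually.of_forall fun p => ?_) ?_
    · have : Measurable (F M) := by
        rw [hF]
        fun_prop
      exact this.aestronglyMeasurable
    · rw [hF]
      simp only [norm_mul, norm_inv, Complex.norm_natCast]
      have : ‖∑ n ∈ Finset.range M, G n p‖ ≤ M :=
        (norm_sum_le (Finset.range M) fun n => G n p).trans (by simp [hG1])
      rcases Nat.eq_zero_or_pos M with rfl | hM
      · simp
      · rw [inv_mul_le_iff₀ (by exact_mod_cast hM), mul_one]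
        exact this
    · filter_upwards [hae] with p hp
      set w := ψ p.1 * conj (ψ p.2) with hw
      have hw1 : ‖w‖ = 1 := by simp [hw, hψ1]
      have hw0 : w - 1 ≠ 0 := sub_ne_zero.2 hp
      have hsum : ∀ M, F M p = (M : ℂ)⁻¹ * ((χ p.1 * conj (χ p.2)) * ((w ^ M - 1) / (w - 1))) := by
        intro M
        rw [hF]
        simp only
        rw [← geom_sum_eq hp]
        congr 1
        rw [Finset.mul_sum]
        refine Finset.sum_congr rfl fun n _ => ?_
        simp only [hG, hw, map_mul, map_pow]
        ring
      simp_rw [hsum]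
      refine squeeze_zero_norm (a := fun M : ℕ => (M : ℝ)⁻¹ * (2 / ‖w - 1‖)) (fun M => ?_) ?_
      · simp only [norm_mul, norm_inv, norm_div, Complex.norm_natCast, hχ1, one_mul,
          RCLike.norm_conj]
        gcongr
        calc ‖w ^ M - 1‖ ≤ ‖w ^ M‖ + ‖(1 : ℂ)‖ := norm_sub_le _ _
          _ = 2 := by rw [norm_pow, hw1]; norm_num
      · simpa using tendsto_inv_atTop_nhds_zero_nat.mul_const (2 / ‖w - 1‖)
  rw [integral_zero] at hlim
  have hconst : ∀ᶠ M : ℕ in atTop,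
      ∫ p, F M p ∂(μ.prod μ) = ((‖∫ x, χ x ∂μ‖ ^ 2 : ℝ) : ℂ) := by
    filter_upwards [eventually_ge_atTop 1] with M hM
    rw [hF]
    simp only
    rw [integral_const_mul, integral_finsetSum _ fun n _ => hGi n]
    simp only [hGint, Finset.sum_const, Finset.card_range, nsmul_eq_mul]
    rw [← mul_assoc, inv_mul_cancel₀ (by exact_mod_cast Nat.one_le_iff_ne_zero.1 hM), one_mul]
  have h0 := tendsto_nhds_unique hlim (tendsto_const_nhds.congr' (hconst.mono fun _ h => h.symm))
  have h1 : ‖∫ x, χ x ∂μ‖ ^ 2 = 0 := by exact_mod_cast h0.symm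
  exact norm_eq_zero.1 (pow_eq_zero_iff two_ne_zero |>.1 h1)

section Discrete

variable [DiscreteTopology Λ] [IsZLattice ℝ Λ]

instance : CompactSpace (Torus Λ) where
  isCompact_univ := by
    have := IsZLattice.isCompact_range_of_periodic Λ (proj Λ) continuous_proj fun z w hw => by
      rw [proj_add, proj_eq_zero_iff.2 hw, add_zero]
    rwa [proj_surjective.range_eq] at this

/-- The coordinate forms of a lattice basis are integral on `Λ`; if they all take integral values at
`z - w`, then `z - w` lies in `Λ`. -/
theorem exists_character_ne {x y : Torus Λ} (hxy : x ≠ y) :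
    ∃ l : dualLattice Λ, character l x ≠ character l y := by
  obtain ⟨z, rfl⟩ := proj_surjective x
  obtain ⟨w, rfl⟩ := proj_surjective y
  by_contra! h
  let b := Module.Free.chooseBasis ℤ Λ
  let β := b.ofZLatticeBasis ℝ Λ
  have hβ : ∀ i, β.coord i ∈ dualLattice Λ := fun i v hv =>
    ⟨b.repr ⟨v, hv⟩ i, b.ofZLatticeBasis_repr_apply ℝ Λ ⟨v, hv⟩ i⟩
  have h1 : ∀ i, ∃ n : ℤ, β.coord i (z - w) = n := fun i => by
    have := h ⟨β.coord i, hβ i⟩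
    rw [character_proj, character_proj, expTwoPi_sub_eq_one_iff] at this
    simpa only [map_sub] using this
  choose n hn using h1
  refine hxy (proj_eq_iff.2 ?_)
  rw [← β.sum_repr (z - w)]
  refine Λ.sum_mem fun i _ => ?_
  rw [← Module.Basis.coord_apply, hn, Int.cast_smul_eq_zsmul]
  refine Λ.smul_mem _ ?_
  rw [b.ofZLatticeBasis_apply ℝ Λ]
  exact (b i).2

/-- A finite measure on the torus is determined by its Fourier coefficients. -/
theorem measure_ext_of_integral_character {m m' : Measure (Torus Λ)} [IsFiniteMeasure m]
    [IsFiniteMeasure m'] (h : ∀ l : dualLattice Λ, ∫ x, character l x ∂m = ∫ x, character l x ∂m') :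
    m = m' := by
  let e : dualLattice Λ → BoundedContinuousFunction (Torus Λ) ℂ := fun l =>
    BoundedContinuousFunction.mkOfCompact (character l)
  have hone : e 0 = 1 := by
    ext x
    obtain ⟨z, rfl⟩ := proj_surjective x
    exact expTwoPi_zero
  have hmul : ∀ l l', e l * e l' = e (l + l') := fun l l' => by
    ext x
    obtain ⟨z, rfl⟩ := proj_surjective x
    exact (expTwoPi_add _ _).symm
  have hstar : ∀ l, star (e l) = e (-l) := fun l => by
    ext x
    obtain ⟨z, rfl⟩ := proj_surjective x
    exact star_expTwoPi _
  -- Trigonometric polynomials form a point-separating star-subalgebra, so they determine finite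
  -- measures.
  let A : StarSubalgebra ℂ (BoundedContinuousFunction (Torus Λ) ℂ) :=
    { Submodule.toSubalgebra (Submodule.span ℂ (range e))
        (hone ▸ Submodule.subset_span (mem_range_self 0)) (fun f g hf hg => by
          have := Submodule.mul_mem_mul hf hg
          rw [Submodule.span_mul_span] at this
          refine Submodule.span_mono ?_ this
          rintro _ ⟨_, ⟨l, rfl⟩, _, ⟨l', rfl⟩, rfl⟩
          exact ⟨l + l', (hmul l l').symm⟩) with
      star_mem' := fun {f} hf => by
        change f ∈ Submodule.span ℂ (range e) at hf
        change star f ∈ Submodule.span ℂ (range e)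
        induction hf using Submodule.span_induction with
        | mem f hf =>
          obtain ⟨l, rfl⟩ := hf
          exact Submodule.subset_span ⟨-l, (hstar l).symm⟩
        | zero => rw [star_zero]; exact Submodule.zero_mem _
        | add f g _ _ hf hg => rw [star_add]; exact Submodule.add_mem _ hf hg
        | smul c f _ hf => rw [star_smul]; exact Submodule.smul_mem _ _ hf }
  refine ext_of_forall_mem_subalgebra_integral_eq_of_pseudoEMetric_complete_countable (𝕜 := ℂ)
    (A := A) ?_ ?_
  · intro x y hxy
    obtain ⟨l, hl⟩ := exists_character_ne hxy
    refine ⟨character l, ⟨character l, ⟨e l, Submodule.subset_span ⟨l, rfl⟩, rfl⟩, rfl⟩, hl⟩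
  · intro f hf
    change f ∈ Submodule.span ℂ (range e) at hf
    induction hf using Submodule.span_induction with
    | mem f hf =>
      obtain ⟨l, rfl⟩ := hf
      exact h l
    | zero => simp
    | add f g _ _ hf hg =>
      simp only [BoundedContinuousFunction.coe_add, Pi.add_apply]
      rw [integral_add (f.integrable m) (g.integrable m),
        integral_add (f.integrable m') (g.integrable m'), hf, hg]
    | smul c f _ hf =>
      simp only [BoundedContinuousFunction.coe_smul, integral_smul, hf]

/-- A finite measure on the torus is invariant under a translation `t` if its Fourier coefficients
vanish at all characters which are not trivial at `t`. -/
theorem map_add_eq_self_of_integral_character {m : Measure (Torus Λ)} [IsFiniteMeasure m]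
    {t : Torus Λ} (h : ∀ l : dualLattice Λ, character l t = 1 ∨ ∫ x, character l x ∂m = 0) :
    m.map (fun x => t + x) = m := by
  refine measure_ext_of_integral_character fun l => ?_
  rw [integral_map (measurable_const_add t).aemeasurable
    (character l).continuous.aestronglyMeasurable]
  simp only [character_add_right, integral_const_mul]
  rcases h l with h | h <;> simp [h]

end Discrete

end AbelianSurface

namespace AbelianSurface

variable {Λ : Submodule ℤ (ℂ × ℂ)}

/-! ## Rational subspaces and translates of subtori -/

variable (Λ) in
/-- A real subspace of `ℂ²` is rational if it is cut out by real forms integral on `Λ`. -/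
def IsRational (V : Submodule ℝ (ℂ × ℂ)) : Prop :=
  ∃ s : Finset (dualLattice Λ), ∀ v, v ∈ V ↔ ∀ l ∈ s, l.1 v = 0

variable (Λ) in
/-- The image in the torus of a real subspace of `ℂ²`. -/
noncomputable def subtorus (V : Submodule ℝ (ℂ × ℂ)) : AddSubgroup (Torus Λ) :=
  V.toAddSubgroup.map (QuotientAddGroup.mk' Λ.toAddSubgroup)

theorem proj_mem_subtorus {V : Submodule ℝ (ℂ × ℂ)} {v : ℂ × ℂ} (hv : v ∈ V) :
    proj Λ v ∈ subtorus Λ V := ⟨v, hv, rfl⟩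

theorem proj_mem_subtorus_iff {V : Submodule ℝ (ℂ × ℂ)} {z : ℂ × ℂ} :
    proj Λ z ∈ subtorus Λ V ↔ ∃ w ∈ Λ, z - w ∈ V := by
  constructor
  · rintro ⟨v, hv, hvz⟩
    refine ⟨z - v, proj_eq_iff.1 hvz.symm, ?_⟩
    rwa [sub_sub_cancel]
  · rintro ⟨w, hw, h⟩
    exact ⟨z - w, h, proj_eq_iff.2 (by simpa using hw)⟩

theorem mem_translate_iff {a x : Torus Λ} {S : AddSubgroup (Torus Λ)} :
    x ∈ translate a S ↔ x - a ∈ S := by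
  constructor
  · rintro ⟨s, hs, rfl⟩
    simpa using hs
  · intro h
    exact ⟨x - a, h, by simp⟩

theorem translate_eq_of_mem {a x : Torus Λ} {S : AddSubgroup (Torus Λ)} (hx : x ∈ translate a S) :
    translate x S = translate a S := by
  ext y
  rw [mem_translate_iff] at *
  rw [mem_translate_iff]
  constructor
  · intro h
    simpa using S.add_mem h hx
  · intro h
    simpa using S.sub_mem h hx

theorem isRational_top : IsRational Λ ⊤ := ⟨∅, by simp⟩

theorem translate_subtorus_top (a : Torus Λ) : translate a (subtorus Λ ⊤) = univ := by
  refine eq_univ_of_forall fun x => mem_translate_iff.2 ?_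
  obtain ⟨z, hz⟩ := proj_surjective (x - a)
  rw [← hz]
  exact proj_mem_subtorus trivial

theorem translate_subtorus_bot (a : Torus Λ) : translate a (subtorus Λ ⊥) = {a} := by
  ext x
  rw [mem_translate_iff, mem_singleton_iff]
  constructor
  · rintro ⟨v, hv, hvx⟩
    have hv0 : v = 0 := hv
    rw [hv0] at hvx
    exact sub_eq_zero.1 hvx.symm
  · rintro rfl
    rw [sub_self]
    exact zero_mem _

theorem IsRational.inf_ker {V : Submodule ℝ (ℂ × ℂ)} (hV : IsRational Λ V) (l : dualLattice Λ) :
    IsRational Λ (V ⊓ LinearMap.ker l.1) := by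
  classical
  obtain ⟨s, hs⟩ := hV
  refine ⟨insert l s, fun v => ?_⟩
  rw [Submodule.mem_inf, hs, LinearMap.mem_ker, Finset.forall_mem_insert, and_comm]

/-- The pull-back of an integral form by an endomorphism preserving the lattice. -/
noncomputable def dualLatticeComp (l : dualLattice Λ) (A : Module.End ℂ (ℂ × ℂ)) (hA : ∀ v ∈ Λ, A v ∈ Λ) :
    dualLattice Λ :=
  ⟨l.1 ∘ₗ A.restrictScalars ℝ, fun v hv => l.2 _ (hA v hv)⟩

theorem IsRational.map {V : Submodule ℝ (ℂ × ℂ)} (hV : IsRational Λ V)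
    {A A' : Module.End ℂ (ℂ × ℂ)} (h : A * A' = 1) (h' : A' * A = 1) (hA' : ∀ v ∈ Λ, A' v ∈ Λ) :
    IsRational Λ (V.map (A.restrictScalars ℝ)) := by
  classical
  obtain ⟨s, hs⟩ := hV
  refine ⟨s.image fun l => dualLatticeComp l A' hA', fun v => ?_⟩
  have hv : v ∈ V.map (A.restrictScalars ℝ) ↔ A' v ∈ V := by
    constructor
    · rintro ⟨w, hw, rfl⟩
      have : A' (A w) = w := congrArg (fun l => l w) h'
      simpa [this] using hw
    · intro hv
      exact ⟨A' v, hv, congrArg (fun l => l v) h⟩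
  rw [hv, hs]
  simp only [Finset.forall_mem_image]
  rfl

theorem finrank_map_of_mul_eq_one {V : Submodule ℝ (ℂ × ℂ)} {A A' : Module.End ℂ (ℂ × ℂ)}
    (h' : A' * A = 1) : Module.finrank ℝ (V.map (A.restrictScalars ℝ)) = Module.finrank ℝ V := by
  have hinj : Function.Injective (A.restrictScalars ℝ) :=
    Function.LeftInverse.injective (g := A') fun v => congrArg (fun l => l v) h'
  exact (Submodule.equivMapOfInjective _ hinj V).finrank_eq.symm

theorem IsAffine.image_translate {g : Torus Λ → Torus Λ} {A : Module.End ℂ (ℂ × ℂ)} {b : ℂ × ℂ}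
    (hg : IsAffine g A b) (a : Torus Λ) (V : Submodule ℝ (ℂ × ℂ)) :
    g '' translate a (subtorus Λ V) = translate (g a) (subtorus Λ (V.map (A.restrictScalars ℝ))) := by
  obtain ⟨α, rfl⟩ := proj_surjective a
  have key : ∀ v, g (proj Λ α + proj Λ v) = g (proj Λ α) + proj Λ (A v) := fun v => by
    rw [← proj_add, hg, hg, map_add, ← proj_add]
    congr 1
    abel
  ext x
  constructor
  · rintro ⟨_, ⟨_, ⟨v, hv, rfl⟩, rfl⟩, rfl⟩
    refine ⟨proj Λ (A v), proj_mem_subtorus ⟨v, hv, rfl⟩, (key v).symm⟩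
  · rintro ⟨_, ⟨_, ⟨v, hv, rfl⟩, rfl⟩, rfl⟩
    exact ⟨_, ⟨_, proj_mem_subtorus hv, rfl⟩, key v⟩

/-- The preimage in `ℂ²` is `V + Λ`. The integral forms cutting out `V` describe it as the preimage
of a set of integer vectors, and every set of integer vectors is closed in the real space. -/
theorem isClosed_subtorus {V : Submodule ℝ (ℂ × ℂ)} (hV : IsRational Λ V) :
    IsClosed (subtorus Λ V : Set (Torus Λ)) := by
  obtain ⟨s, hs⟩ := hV
  have hq : IsQuotientMap (proj Λ) := isQuotientMap_quotient_mk'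
  rw [← hq.isClosed_preimage]
  let L : ℂ × ℂ → (s → ℝ) := fun z l => l.1.1 z
  have hL : Continuous L :=
    continuous_pi fun l => LinearMap.continuous_of_finiteDimensional l.1.1
  let T : Set (s → ℤ) := {n | ∃ w ∈ Λ, ∀ l : s, l.1.1 w = n l}
  let c : (s → ℤ) → (s → ℝ) := fun n l => (n l : ℝ)
  have hc : IsClosedEmbedding c :=
    IsClosedEmbedding.piMap fun _ => Int.isClosedEmbedding_coe_real
  have : proj Λ ⁻¹' (subtorus Λ V : Set (Torus Λ)) = L ⁻¹' (c '' T) := by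
    ext z
    rw [mem_preimage, SetLike.mem_coe, proj_mem_subtorus_iff, mem_preimage]
    constructor
    · rintro ⟨w, hw, h⟩
      have h1 : ∀ l : s, ∃ n : ℤ, l.1.1 w = n := fun l => l.1.2 w hw
      choose n hn using h1
      refine ⟨n, ⟨w, hw, hn⟩, funext fun l => ?_⟩
      have := (hs _).1 h l.1 l.2
      rw [map_sub, sub_eq_zero] at this
      exact (hn l).symm.trans this.symm
    · rintro ⟨n, ⟨w, hw, hn⟩, h⟩
      refine ⟨w, hw, (hs _).2 fun l hl => ?_⟩
      have := congrFun h ⟨l, hl⟩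
      rw [map_sub, sub_eq_zero]
      exact this.symm.trans (hn ⟨l, hl⟩).symm
  rw [this]
  exact (hc.isClosedMap _ (isClosed_discrete T)).preimage hL

theorem isClosed_translate {S : AddSubgroup (Torus Λ)} (hS : IsClosed (S : Set (Torus Λ)))
    (a : Torus Λ) : IsClosed (translate a S) := by
  have : translate a S = (fun x => x - a) ⁻¹' (S : Set (Torus Λ)) := by
    ext x
    exact mem_translate_iff
  rw [this]
  exact hS.preimage (by fun_prop)

/-- A linear map preserving a rational subtorus preserves the subspace. -/
theorem IsRational.mem_of_forall_smul {V : Submodule ℝ (ℂ × ℂ)} (hV : IsRational Λ V) {w : ℂ × ℂ}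
    (h : ∀ t : ℝ, proj Λ (t • w) ∈ subtorus Λ V) : w ∈ V := by
  obtain ⟨s, hs⟩ := hV
  refine (hs w).2 fun l hl => ?_
  have hint : ∀ t : ℝ, ∃ n : ℤ, t * l.1 w = n := fun t => by
    obtain ⟨u, hu, hut⟩ := proj_mem_subtorus_iff.1 (h t)
    obtain ⟨n, hn⟩ := l.2 u hu
    refine ⟨n, ?_⟩
    have := (hs _).1 hut l hl
    rw [map_sub, sub_eq_zero, map_smul, smul_eq_mul] at this
    rw [this, hn]
  by_contra h0
  -- This multiple of `w` makes the form equal to 1/2, which is not an integer.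
  obtain ⟨n, hn⟩ := hint (1 / (2 * l.1 w))
  have h2 : (1 : ℝ) = 2 * n := by
    rw [← hn]
    field_simp
  have h3 : (1 : ℤ) = 2 * n := by exact_mod_cast h2
  omega

section Measure

variable {μ : Measure (Torus Λ)} {d : ℕ}

/-- The translates of rational subtori of dimension less than `d` are negligible. -/
def NullBelowDim (μ : Measure (Torus Λ)) (d : ℕ) : Prop :=
  ∀ V, IsRational Λ V → Module.finrank ℝ V < d → ∀ a, μ (translate a (subtorus Λ V)) = 0

/-- Level sets of non-constant characters on a translate of a rational subtorus of minimal
dimension are negligible. -/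
theorem measure_level_eq_zero
    (hmin : NullBelowDim μ d)
    {V : Submodule ℝ (ℂ × ℂ)} (hV : IsRational Λ V) (hd : Module.finrank ℝ V = d)
    {l : dualLattice Λ} (hl : ∃ v ∈ V, l.1 v ≠ 0) (a : Torus Λ) (c : ℂ) :
    μ (translate a (subtorus Λ V) ∩ {x | character l x = c}) = 0 := by
  classical
  set W := V ⊓ LinearMap.ker l.1
  have hW : Module.finrank ℝ W < d := by
    rw [← hd]
    refine Submodule.finrank_lt_finrank_of_lt (lt_of_le_of_ne inf_le_left fun h => ?_)
    obtain ⟨v, hv, hlv⟩ := hl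
    rw [← h] at hv
    exact hlv hv.2
  obtain ⟨α, rfl⟩ := proj_surjective a
  by_cases hne : ∃ v₀ ∈ V, character l (proj Λ (α + v₀)) = c
  swap
  · refine measure_mono_null ?_ (measure_empty (μ := μ))
    rintro _ ⟨⟨_, ⟨v, hv, rfl⟩, rfl⟩, hx⟩
    exact hne ⟨v, hv, hx⟩
  obtain ⟨v₀, hv₀, hc⟩ := hne
  -- On the translate, the level set is where `l v - l v₀` is an integer `n`: countably many
  -- translates of `W`, with base points `p n`. For integers not attained the value 0 only adds
  -- another null translate.
  let p : ℤ → ℂ × ℂ := fun n =>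
    if h : ∃ v ∈ V, l.1 v - l.1 v₀ = n then h.choose else 0
  refine measure_mono_null ?_ (measure_iUnion_null fun n : ℤ =>
    hmin W (hV.inf_ker l) hW (proj Λ (α + p n)))
  rintro _ ⟨⟨_, ⟨v, hv, rfl⟩, rfl⟩, hx⟩
  have hx' : character l (proj Λ (α + v)) = character l (proj Λ (α + v₀)) := hx.trans hc.symm
  rw [character_proj, character_proj, expTwoPi_sub_eq_one_iff] at hx'
  obtain ⟨n, hn⟩ := hx'
  rw [map_add, map_add, add_sub_add_left_eq_sub] at hn
  have h : ∃ v ∈ V, l.1 v - l.1 v₀ = n := ⟨v, hv, hn⟩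
  refine mem_iUnion.2 ⟨n, mem_translate_iff.2 ?_⟩
  change proj Λ (α + v) - proj Λ (α + p n) ∈ _
  rw [← proj_sub, add_sub_add_left_eq_sub]
  refine proj_mem_subtorus ?_
  have hp : p n = h.choose := dif_pos h
  have hps := h.choose_spec
  rw [← hp] at hps
  refine ⟨V.sub_mem hv hps.1, ?_⟩
  rw [SetLike.mem_coe, LinearMap.mem_ker, map_sub]
  linarith [hps.2]

/-- With equal directions these are distinct cosets. Otherwise, the dimensions being equal, some
form defining `V'` is nonzero on `V`; its character is constant on the second translate, so the
intersection lies in a null level set. -/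
theorem aedisjoint_translate
    (hmin : NullBelowDim μ d)
    {V V' : Submodule ℝ (ℂ × ℂ)} (hV : IsRational Λ V) (hd : Module.finrank ℝ V = d)
    (hV' : IsRational Λ V') (hd' : Module.finrank ℝ V' = d) {a a' : Torus Λ}
    (hne : translate a (subtorus Λ V) ≠ translate a' (subtorus Λ V')) :
    AEDisjoint μ (translate a (subtorus Λ V)) (translate a' (subtorus Λ V')) := by
  by_cases hVV : V = V'
  · subst hVV
    refine Disjoint.aedisjoint (disjoint_left.2 fun x hx hx' => hne ?_)
    rw [← translate_eq_of_mem hx, translate_eq_of_mem hx']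
  obtain ⟨s, hs⟩ := hV'
  have : ∃ l ∈ s, ∃ v ∈ V, l.1 v ≠ 0 := by
    by_contra! h
    have hle : V ≤ V' := fun v hv => (hs v).2 fun l hl => h l hl v hv
    exact hVV (Submodule.eq_of_le_of_finrank_eq hle (hd.trans hd'.symm))
  obtain ⟨l, hl, hlV⟩ := this
  refine measure_mono_null (inter_subset_inter_right _ ?_)
    (measure_level_eq_zero hmin hV hd hlV a (character l a'))
  rintro _ ⟨_, ⟨v, hv, rfl⟩, rfl⟩
  change character l (a' + proj Λ v) = _
  rw [character_add_right, character_proj, (hs v).1 hv l hl, expTwoPi_zero, mul_one]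

end Measure

end AbelianSurface

namespace AbelianSurface

variable {Λ : Submodule ℤ (ℂ × ℂ)}

/-! ## Translates of minimal dimension charged by an invariant measure -/

section Measure

variable [DiscreteTopology Λ] [IsZLattice ℝ Λ] {μ : Measure (Torus Λ)} {d : ℕ}
  {Γ : Subgroup (Torus Λ ≃ₜ Torus Λ)}

theorem exists_image_translate_eq {g : Torus Λ ≃ₜ Torus Λ} (hg : g ∈ Aut Λ)
    {V : Submodule ℝ (ℂ × ℂ)} (hV : IsRational Λ V) (a : Torus Λ) :
    ∃ a' V', IsRational Λ V' ∧ Module.finrank ℝ V' = Module.finrank ℝ V ∧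
      g '' translate a (subtorus Λ V) = translate a' (subtorus Λ V') := by
  let f : Aut Λ := ⟨g, hg⟩
  obtain ⟨b, hb⟩ := exists_isAffine_linearPart f
  obtain ⟨b', hb'⟩ := exists_isAffine_linearPart f⁻¹
  have h1 : linearPart Λ f * linearPart Λ f⁻¹ = 1 := by rw [← map_mul, mul_inv_cancel, map_one]
  have h2 : linearPart Λ f⁻¹ * linearPart Λ f = 1 := by rw [← map_mul, inv_mul_cancel, map_one]
  exact ⟨_, _, hV.map h1 h2 fun _ => hb'.map_mem, finrank_map_of_mul_eq_one h2,
    hb.image_translate a V⟩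

omit [DiscreteTopology Λ] [IsZLattice ℝ Λ] in
theorem measure_image_eq [BorelSpace (Torus Λ)] {g : Torus Λ ≃ₜ Torus Λ} (hg : μ.map g = μ)
    (T : Set (Torus Λ)) : μ (g '' T) = μ T := by
  conv_lhs => rw [← hg]
  rw [g.measurableEmbedding.map_apply]
  congr 1
  exact preimage_image_eq T g.injective

/-- The orbit of a subset of the torus. -/
def setOrbit (Γ : Subgroup (Torus Λ ≃ₜ Torus Λ)) (T : Set (Torus Λ)) : Set (Set (Torus Λ)) :=
  {T' | ∃ g ∈ Γ, g '' T = T'}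

theorem exists_eq_of_mem_setOrbit (hAut : Γ ≤ Aut Λ) {V : Submodule ℝ (ℂ × ℂ)}
    (hV : IsRational Λ V) (hd : Module.finrank ℝ V = d) {a : Torus Λ} {T : Set (Torus Λ)}
    (hT : T ∈ setOrbit Γ (translate a (subtorus Λ V))) :
    ∃ a' V', IsRational Λ V' ∧ Module.finrank ℝ V' = d ∧ T = translate a' (subtorus Λ V') := by
  obtain ⟨g, hg, rfl⟩ := hT
  obtain ⟨a', V', h1, h2, h3⟩ := exists_image_translate_eq (hAut hg) hV a
  exact ⟨a', V', h1, h2.trans hd, h3⟩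

theorem pairwise_aedisjoint_setOrbit (hAut : Γ ≤ Aut Λ) (hmin : NullBelowDim μ d)
    {V : Submodule ℝ (ℂ × ℂ)} (hV : IsRational Λ V) (hd : Module.finrank ℝ V = d) {a : Torus Λ} :
    Pairwise (Function.onFun (AEDisjoint μ)
      fun T : setOrbit Γ (translate a (subtorus Λ V)) => (T : Set (Torus Λ))) := by
  rintro ⟨T, hT⟩ ⟨T', hT'⟩ hne
  obtain ⟨a₁, V₁, h1, h2, rfl⟩ := exists_eq_of_mem_setOrbit hAut hV hd hT
  obtain ⟨a₂, V₂, h3, h4, rfl⟩ := exists_eq_of_mem_setOrbit hAut hV hd hT'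
  exact aedisjoint_translate hmin h1 h2 h3 h4 fun h => hne (Subtype.ext h)

theorem measurableSet_of_mem_setOrbit (hAut : Γ ≤ Aut Λ) {V : Submodule ℝ (ℂ × ℂ)}
    (hV : IsRational Λ V) {a : Torus Λ} {T : Set (Torus Λ)}
    (hT : T ∈ setOrbit Γ (translate a (subtorus Λ V))) : MeasurableSet T := by
  obtain ⟨a', V', h1, -, rfl⟩ := exists_eq_of_mem_setOrbit hAut hV rfl hT
  exact (isClosed_translate (isClosed_subtorus h1) a').measurableSet

/-- The members of the orbit have the same positive mass and are almost disjoint, while the total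
mass is finite. -/
theorem finite_setOrbit [IsFiniteMeasure μ] (hAut : Γ ≤ Aut Λ) (hinv : ∀ g ∈ Γ, μ.map g = μ)
    (hmin : NullBelowDim μ d) {V : Submodule ℝ (ℂ × ℂ)} (hV : IsRational Λ V)
    (hd : Module.finrank ℝ V = d) {a : Torus Λ} (hpos : μ (translate a (subtorus Λ V)) ≠ 0) :
    (setOrbit Γ (translate a (subtorus Λ V))).Finite := by
  have h := Measure.finite_const_le_meas_of_disjoint_iUnion₀ μ (pos_iff_ne_zero.2 hpos)
    (As := fun T : setOrbit Γ (translate a (subtorus Λ V)) => T.1)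
    (fun T => (measurableSet_of_mem_setOrbit hAut hV T.2).nullMeasurableSet)
    (pairwise_aedisjoint_setOrbit hAut hmin hV hd) (measure_ne_top μ _)
  have h2 : {T : setOrbit Γ (translate a (subtorus Λ V)) |
      μ (translate a (subtorus Λ V)) ≤ μ T.1} = univ := by
    refine eq_univ_of_forall fun T => ?_
    obtain ⟨_, g, hg, rfl⟩ := T
    exact (measure_image_eq (hinv g hg) _).ge
  rw [h2] at h
  exact finite_coe_iff.1 (finite_univ_iff.1 h)

theorem exists_pow_image_eq [IsFiniteMeasure μ] (hAut : Γ ≤ Aut Λ) (hinv : ∀ g ∈ Γ, μ.map g = μ)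
    (hmin : NullBelowDim μ d) {V : Submodule ℝ (ℂ × ℂ)} (hV : IsRational Λ V)
    (hd : Module.finrank ℝ V = d) {a : Torus Λ} (hpos : μ (translate a (subtorus Λ V)) ≠ 0)
    {g : Torus Λ ≃ₜ Torus Λ} (hg : g ∈ Γ) :
    ∃ k : ℕ, 1 ≤ k ∧ (g ^ k : Torus Λ ≃ₜ Torus Λ) '' translate a (subtorus Λ V) =
      translate a (subtorus Λ V) := by
  set T := translate a (subtorus Λ V)
  have hfin : Finite (setOrbit Γ T) := (finite_setOrbit hAut hinv hmin hV hd hpos).to_subtype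
  obtain ⟨m, n, hmn, h⟩ := Finite.exists_ne_map_eq_of_infinite fun n : ℕ =>
    (⟨(g ^ n : Torus Λ ≃ₜ Torus Λ) '' T, g ^ n, Γ.pow_mem hg n, rfl⟩ : setOrbit Γ T)
  have h' : (g ^ m : Torus Λ ≃ₜ Torus Λ) '' T = (g ^ n : Torus Λ ≃ₜ Torus Λ) '' T :=
    congrArg Subtype.val h
  clear h
  wlog hlt : m < n generalizing m n
  · exact this n m hmn.symm h'.symm (lt_of_le_of_ne (not_lt.1 hlt) hmn.symm)
  refine ⟨n - m, by omega, ?_⟩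
  refine (g ^ m : Torus Λ ≃ₜ Torus Λ).injective.image_injective ?_
  rw [h', ← image_comp]
  change ((g ^ m * g ^ (n - m) : Torus Λ ≃ₜ Torus Λ)) '' T = _
  rw [← pow_add, Nat.add_sub_cancel' hlt.le]

omit [DiscreteTopology Λ] [IsZLattice ℝ Λ] in
theorem one_add_pow_of_sq_eq_zero {N : Module.End ℂ (ℂ × ℂ)} (h : N * N = 0) (n : ℕ) :
    (1 + N) ^ n = 1 + (n : ℂ) • N := by
  induction n with
  | zero => simp
  | succ n ih =>
    rw [pow_succ, ih, mul_add, mul_one, add_mul, one_mul, smul_mul_assoc, h, smul_zero, add_zero]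
    push_cast
    rw [add_smul, one_smul, add_assoc]

omit [DiscreteTopology Λ] [IsZLattice ℝ Λ] in
/-- A unipotent affine map preserving a translate of a rational subtorus preserves its
direction. -/
theorem IsAffine.nilpotent_mem {g : Torus Λ → Torus Λ} {N : Module.End ℂ (ℂ × ℂ)} {b : ℂ × ℂ}
    (hg : IsAffine g (1 + N) b) {V : Submodule ℝ (ℂ × ℂ)} (hV : IsRational Λ V) {a : Torus Λ}
    (hT : g '' translate a (subtorus Λ V) = translate a (subtorus Λ V)) {v : ℂ × ℂ} (hv : v ∈ V) :
    N v ∈ V := by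
  obtain ⟨α, rfl⟩ := proj_surjective a
  have h1 : ∀ w ∈ V, g (proj Λ (α + w)) ∈ translate (proj Λ α) (subtorus Λ V) := fun w hw => by
    rw [← hT]
    exact ⟨_, ⟨_, proj_mem_subtorus hw, rfl⟩, rfl⟩
  -- Preserving the translate only controls `N v` modulo `Λ`; having this for every real multiple of
  -- `v` puts `N v` itself in `V`.
  refine hV.mem_of_forall_smul fun t => ?_
  have h2 := h1 (t • v) (V.smul_mem t hv)
  have h3 := h1 0 V.zero_mem
  rw [hg, mem_translate_iff] at h2 h3
  have h4 := (subtorus Λ V).sub_mem h2 h3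
  rw [← proj_sub, ← proj_sub, ← proj_sub] at h4
  have h5 := (subtorus Λ V).sub_mem h4 (proj_mem_subtorus (V.smul_mem t hv))
  rw [← proj_sub] at h5
  convert h5 using 2
  have h6 : N (t • v) = t • N v := map_smul (N.restrictScalars ℝ) t v
  simp only [map_add, LinearMap.add_apply, Module.End.one_apply, map_zero, h6]
  abel

omit [IsZLattice ℝ Λ] in
/-- Vanishing of the Fourier coefficients at the characters which are not invariant under a
unipotent affine map. -/
theorem setIntegral_character_eq_zero [IsFiniteMeasure μ] (hmin : NullBelowDim μ d)
    {V : Submodule ℝ (ℂ × ℂ)} (hV : IsRational Λ V) (hd : Module.finrank ℝ V = d) {a : Torus Λ}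
    {g : Torus Λ ≃ₜ Torus Λ} {N : Module.End ℂ (ℂ × ℂ)} {b : ℂ × ℂ} (hg : IsAffine g (1 + N) b)
    (hN : N * N = 0) (hinv : μ.map g = μ)
    (hT : g '' translate a (subtorus Λ V) = translate a (subtorus Λ V))
    {l : dualLattice Λ} (hl : ∃ v ∈ V, l.1 (N v) ≠ 0) :
    ∫ x in translate a (subtorus Λ V), character l x ∂μ = 0 := by
  set T := translate a (subtorus Λ V) with hTdef
  have hTm : MeasurableSet T := (isClosed_translate (isClosed_subtorus hV) a).measurableSet
  have hNΛ : ∀ v ∈ Λ, N v ∈ Λ := fun v hv => by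
    have := Λ.sub_mem (hg.map_mem hv) hv
    simpa using this
  let l' := dualLatticeComp l N hNΛ
  refine integral_eq_zero_of_norm_integral_mul_pow (ψ := character l')
    (character l).continuous.measurable (character l').continuous.measurable (norm_character l)
    (norm_character l') (fun c => ?_) fun n => ?_
  · rw [Measure.restrict_apply (measurableSet_eq_fun (character l').continuous.measurable
      measurable_const), inter_comm]
    exact measure_level_eq_zero hmin hV hd hl a c
  · obtain ⟨e, he⟩ := hg.pow n
    rw [one_add_pow_of_sq_eq_zero hN] at he
    -- A lift of `g ^ n` is `z ↦ z + n N z + e`, which accounts for the phase and for the factor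
    -- `character l' x ^ n`.
    have hchar : ∀ x, character l ((g ^ n : Torus Λ ≃ₜ Torus Λ) x) =
        expTwoPi (l.1 e) * (character l x * character l' x ^ n) := by
      intro x
      obtain ⟨z, rfl⟩ := proj_surjective x
      rw [he, character_proj, character_proj, character_proj, ← expTwoPi_nat_mul, ← expTwoPi_add,
        ← expTwoPi_add]
      congr 1
      have h6 : ((n : ℂ) • N z) = (n : ℝ) • N z := by
        rw [← Complex.coe_smul]; simp
      simp only [LinearMap.add_apply, Module.End.one_apply, LinearMap.smul_apply, h6, map_add,
        map_smul, smul_eq_mul]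
      change _ = l.1 e + (l.1 z + n * l.1 (N z))
      ring
    have hTn : ∀ n : ℕ, (g ^ n : Torus Λ ≃ₜ Torus Λ) '' T = T := by
      intro n
      induction n with
      | zero => exact image_id T
      | succ n ih =>
        rw [pow_succ]
        change ((g ^ n : Torus Λ ≃ₜ Torus Λ) ∘ g) '' T = T
        rw [image_comp, hT, ih]
    have hμn : ∀ n : ℕ, μ.map (g ^ n : Torus Λ ≃ₜ Torus Λ) = μ := by
      intro n
      induction n with
      | zero => exact Measure.map_id
      | succ n ih =>
        rw [pow_succ]
        change μ.map ((g ^ n : Torus Λ ≃ₜ Torus Λ) ∘ g) = μ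
        rw [← Measure.map_map (g ^ n : Torus Λ ≃ₜ Torus Λ).measurable g.measurable, hinv, ih]
    have hpre : (g ^ n : Torus Λ ≃ₜ Torus Λ) ⁻¹' T = T := by
      conv_lhs => rw [← hTn n]
      exact preimage_image_eq T (g ^ n : Torus Λ ≃ₜ Torus Λ).injective
    have h1 : ∫ x in T, character l x ∂μ =
        ∫ x in T, character l ((g ^ n : Torus Λ ≃ₜ Torus Λ) x) ∂μ := by
      have hmp : MeasurePreserving (g ^ n : Torus Λ ≃ₜ Torus Λ) μ μ :=
        ⟨(g ^ n : Torus Λ ≃ₜ Torus Λ).measurable, hμn n⟩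
      have := hmp.setIntegral_preimage_emb
        (g ^ n : Torus Λ ≃ₜ Torus Λ).measurableEmbedding (character l) T
      rw [hpre] at this
      exact this.symm
    rw [h1]
    simp only [hchar, integral_const_mul, norm_mul, norm_expTwoPi, one_mul]

/-- Multiplication by the complex number `c` preserves the real subspace `V` because it equals `N N'
+ N' N`. Being injective in finite dimension it is onto, whence `V = N V + N' V`. -/
theorem exists_smul_eq_of_transversal {N N' : Module.End ℂ (ℂ × ℂ)} {c : ℂ} (hc : c ≠ 0)
    (h : N * N' + N' * N = c • 1) {V : Submodule ℝ (ℂ × ℂ)} (hN : ∀ v ∈ V, N v ∈ V)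
    (hN' : ∀ v ∈ V, N' v ∈ V) {v : ℂ × ℂ} (hv : v ∈ V) : ∃ u ∈ V, N (N' u) + N' (N u) = v := by
  have happ : ∀ u, N (N' u) + N' (N u) = c • u := fun u => congrArg (fun l => l u) h
  have hmem : ∀ u ∈ V, c • u ∈ V := fun u hu => by
    rw [← happ]
    exact V.add_mem (hN _ (hN' _ hu)) (hN' _ (hN _ hu))
  let m : V →ₗ[ℝ] V := (((c • (1 : Module.End ℂ (ℂ × ℂ))) : Module.End ℂ (ℂ × ℂ)).restrictScalars
    ℝ).restrict hmem
  have hinj : Function.Injective m := fun u u' huu => by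
    have : c • (u : ℂ × ℂ) = c • (u' : ℂ × ℂ) := congrArg Subtype.val huu
    exact Subtype.ext (smul_right_injective _ hc this)
  obtain ⟨u, hu⟩ := LinearMap.surjective_of_injective hinj ⟨v, hv⟩
  exact ⟨u, u.2, (happ u).trans (congrArg Subtype.val hu)⟩

/-- A subspace preserved by two transversal nilpotent endomorphisms has even dimension. -/
theorem even_finrank_of_transversal {N N' : Module.End ℂ (ℂ × ℂ)} {c : ℂ} (hc : c ≠ 0)
    (hN2 : N * N = 0) (h : N * N' + N' * N = c • 1) {V : Submodule ℝ (ℂ × ℂ)}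
    (hN : ∀ v ∈ V, N v ∈ V) (hN' : ∀ v ∈ V, N' v ∈ V) : Even (Module.finrank ℝ V) := by
  let f : V →ₗ[ℝ] V := (N.restrictScalars ℝ).restrict hN
  have hf : ∀ v : V, (f v : ℂ × ℂ) = N v := fun _ => rfl
  -- If `N v = 0`, write `v = c u`; then `N u = 0` too, so `v = N (N' u)`. Rank–nullity then gives
  -- twice the rank.
  have hle : LinearMap.range f = LinearMap.ker f := by
    refine le_antisymm ?_ fun v hv => ?_
    · rintro _ ⟨v, rfl⟩
      exact Subtype.ext (congrArg (fun l => l (v : ℂ × ℂ)) hN2)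
    · obtain ⟨u, hu, huv⟩ := exists_smul_eq_of_transversal hc h hN hN' v.2
      have hcu : c • u = v := by rw [← huv]; exact (congrArg (fun l => l u) h).symm
      have hv0 : N v = 0 := congrArg Subtype.val hv
      rw [← hcu, map_smul, smul_eq_zero] at hv0
      rw [hv0.resolve_left hc, map_zero, add_zero] at huv
      exact ⟨⟨N' u, hN' u hu⟩, Subtype.ext huv⟩
  have := LinearMap.finrank_range_add_finrank_ker f
  rw [hle] at this
  exact ⟨_, this.symm⟩

/-- An invariant measure is invariant along the translates of rational subtori of minimal dimension
which it charges; this dimension is even. -/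
theorem exists_invariance [IsFiniteMeasure μ] (hAut : Γ ≤ Aut Λ) (hinv : ∀ g ∈ Γ, μ.map g = μ)
    (hmin : NullBelowDim μ d) (hΓ : IsNonElementary Γ) (hpar : ∃ g ∈ Γ, IsParabolic g)
    {V : Submodule ℝ (ℂ × ℂ)} (hV : IsRational Λ V) (hd : Module.finrank ℝ V = d) {a : Torus Λ}
    (hpos : μ (translate a (subtorus Λ V)) ≠ 0) :
    Even d ∧ ∀ t ∈ subtorus Λ V, (μ.restrict (translate a (subtorus Λ V))).map (fun x => t + x) =
      μ.restrict (translate a (subtorus Λ V)) := by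
  obtain ⟨g, hg, hgpar⟩ := hpar
  obtain ⟨h, N₀, b₀, c₀, hΓh, haff₀, hN₀, hc₀, hanti₀⟩ := exists_transversal hΓ hAut hg hgpar
  -- Passing to powers that stabilize the translate multiplies `N₀ i` by `k i`, hence the
  -- anticommutator by `k 0 * k 1`.
  choose k hk hT using fun i => exists_pow_image_eq hAut hinv hmin hV hd hpos (hΓh i)
  choose b haff using fun i => (haff₀ i).pow (k i)
  simp only [one_add_pow_of_sq_eq_zero (hN₀ _)] at haff
  have hinvk : ∀ i, μ.map (h i ^ k i : Torus Λ ≃ₜ Torus Λ) = μ := fun i =>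
    hinv _ (Γ.pow_mem (hΓh i) _)
  set N : Fin 2 → Module.End ℂ (ℂ × ℂ) := fun i => (k i : ℂ) • N₀ i with hNdef
  have hN : ∀ i, N i * N i = 0 := fun i => by
    simp only [hNdef, smul_mul_smul_comm, hN₀, smul_zero]
  have hanti : N 0 * N 1 + N 1 * N 0 = ((k 0 : ℂ) * k 1 * c₀) • 1 := by
    simp only [hNdef, smul_mul_smul_comm]
    rw [mul_comm (k 1 : ℂ), ← smul_add, hanti₀, smul_smul]
  have hc : (k 0 : ℂ) * k 1 * c₀ ≠ 0 := by
    have := hk 0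
    have := hk 1
    refine mul_ne_zero (mul_ne_zero ?_ ?_) hc₀ <;> exact_mod_cast (by omega)
  have hNV : ∀ i, ∀ v ∈ V, N i v ∈ V := fun i v hv => (haff i).nilpotent_mem hV (hT i) hv
  refine ⟨hd ▸ even_finrank_of_transversal hc (hN 0) hanti (hNV 0) (hNV 1), ?_⟩
  rintro _ ⟨t, ht, rfl⟩
  refine map_add_eq_self_of_integral_character fun l => ?_
  -- Either `l` is nonzero on some `N i V` and its Fourier coefficient vanishes, or `l` vanishes on
  -- `N 0 V + N 1 V = V` and its character is trivial along `V`.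
  by_cases hl : ∃ i, ∃ v ∈ V, l.1 (N i v) ≠ 0
  · obtain ⟨i, hi⟩ := hl
    exact Or.inr (setIntegral_character_eq_zero hmin hV hd (haff i) (hN i) (hinvk i) (hT i) hi)
  · push Not at hl
    left
    obtain ⟨u, hu, rfl⟩ := exists_smul_eq_of_transversal hc hanti (hNV 0) (hNV 1) ht
    refine (character_proj l _).trans ?_
    rw [map_add, hl 0 _ (hNV 1 _ hu), hl 1 _ (hNV 0 _ hu), add_zero, expTwoPi_zero]

end Measure

end AbelianSurface

namespace AbelianSurface

variable {Λ : Submodule ℤ (ℂ × ℂ)}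

/-! ## Haar measures on translates of subtori -/

section Haar

variable [DiscreteTopology Λ] [IsZLattice ℝ Λ]

theorem isAddHaarMeasure_of_map_add {μ : Measure (Torus Λ)} [IsProbabilityMeasure μ]
    (h : ∀ t, μ.map (fun x => t + x) = μ) : μ.IsAddHaarMeasure := by
  have : μ.IsAddLeftInvariant := ⟨h⟩
  exact Measure.isAddHaarMeasure_of_isCompact_nonempty_interior μ univ isCompact_univ
    (by rw [interior_univ]; exact univ_nonempty) (by simp) (by simp)

/-- The map `s ↦ a + s` is a closed embedding whose range carries `m`, so `m` pulls back to an
invariant probability measure on the compact group `S`. -/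
theorem isHaarOnTranslate_of_map_add {m : Measure (Torus Λ)} [IsProbabilityMeasure m]
    {S : AddSubgroup (Torus Λ)} (hS : IsClosed (S : Set (Torus Λ))) {a : Torus Λ}
    (hm : m (translate a S)ᶜ = 0) (h : ∀ t ∈ S, m.map (fun x => t + x) = m) :
    IsHaarOnTranslate a S m := by
  let f : S → Torus Λ := fun s => a + (s : Torus Λ)
  have hf : MeasurableEmbedding f :=
    (((Homeomorph.addLeft a).isClosedEmbedding).comp hS.isClosedEmbedding_subtypeVal).measurableEmbedding
  have hrange : range f = translate a S := by
    ext x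
    constructor
    · rintro ⟨s, rfl⟩
      exact ⟨s, s.2, rfl⟩
    · rintro ⟨s, hs, rfl⟩
      exact ⟨⟨s, hs⟩, rfl⟩
  have hmap : (m.comap f).map f = m := by
    rw [hf.map_comap, hrange]
    exact Measure.restrict_eq_self_of_ae_mem (by rw [ae_iff]; exact hm)
  have : IsProbabilityMeasure (m.comap f) := by
    have : ((m.comap f).map f) univ = 1 := by rw [hmap]; exact measure_univ
    rw [Measure.map_apply hf.measurable MeasurableSet.univ, preimage_univ] at this
    exact ⟨this⟩
  have : CompactSpace S := isCompact_iff_compactSpace.1 hS.isCompact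
  have : (m.comap f).IsAddLeftInvariant := ⟨fun s => by
    have h1 : ((m.comap f).map (fun x => s + x)).map f = (m.comap f).map f := by
      rw [Measure.map_map hf.measurable (measurable_const_add s)]
      have : f ∘ (fun x => s + x) = (fun x => (s : Torus Λ) + x) ∘ f := by
        funext x
        simp only [f, Function.comp_apply, AddSubgroup.coe_add]
        abel
      rw [this, ← Measure.map_map (measurable_const_add _) hf.measurable, hmap, h s s.2]
    have h2 := congrArg (Measure.comap f) h1
    rwa [hf.comap_map, hf.comap_map] at h2⟩
  exact ⟨m.comap f, Measure.isAddHaarMeasure_of_isCompact_nonempty_interior _ univ isCompact_univ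
    (by rw [interior_univ]; exact univ_nonempty) (by simp) (by simp), inferInstance, hmap.symm⟩

-- The whole torus is a charged translate, so a least charged dimension exists.
omit [DiscreteTopology Λ] [IsZLattice ℝ Λ] in
theorem exists_minimal_translate {μ : Measure (Torus Λ)} [IsProbabilityMeasure μ] :
    ∃ d V a, NullBelowDim μ d ∧ IsRational Λ V ∧ Module.finrank ℝ V = d ∧
      μ (translate a (subtorus Λ V)) ≠ 0 := by
  classical
  have hex : ∃ d, ∃ V a, IsRational Λ V ∧ Module.finrank ℝ V = d ∧
      μ (translate a (subtorus Λ V)) ≠ 0 :=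
    ⟨_, ⊤, 0, isRational_top, rfl, by rw [translate_subtorus_top]; simp⟩
  obtain ⟨V, a, h⟩ := Nat.find_spec hex
  refine ⟨Nat.find hex, V, a, fun W hW hlt b => ?_, h⟩
  by_contra hne
  exact Nat.find_min hex hlt ⟨W, b, hW, rfl, hne⟩

/-- The orbit of a charged translate of minimal dimension carries the measure, which is uniformly
distributed on it. -/
theorem exists_translates {Γ : Subgroup (Torus Λ ≃ₜ Torus Λ)} (hAut : Γ ≤ Aut Λ)
    (hΓ : IsNonElementary Γ) (hpar : ∃ g ∈ Γ, IsParabolic g) {μ : Measure (Torus Λ)}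
    [IsProbabilityMeasure μ] (hμ : IsInvariantErgodic Γ μ) {d : ℕ} (hmin : NullBelowDim μ d)
    {V₀ : Submodule ℝ (ℂ × ℂ)} (hV₀ : IsRational Λ V₀) (hd₀ : Module.finrank ℝ V₀ = d)
    {a₀ : Torus Λ} (hpos₀ : μ (translate a₀ (subtorus Λ V₀)) ≠ 0) :
    ∃ (k : ℕ) (S : Fin k → AddSubgroup (Torus Λ)) (a : Fin k → Torus Λ), 0 < k ∧
      (∀ j, IsRealSubtorus d (S j)) ∧
      Function.Injective (fun j => translate (a j) (S j)) ∧
      (∀ g ∈ Γ, g '' (⋃ j, translate (a j) (S j)) = ⋃ j, translate (a j) (S j)) ∧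
      (∀ g ∈ Γ, ∀ i, ∃ j, g '' translate (a i) (S i) = translate (a j) (S j)) ∧
      (∀ i j, ∃ g ∈ Γ, g '' translate (a i) (S i) = translate (a j) (S j)) ∧
      μ (⋃ j, translate (a j) (S j))ᶜ = 0 ∧
      ∀ j, ∃ m : Measure (Torus Λ), IsHaarOnTranslate (a j) (S j) m ∧
        μ.restrict (translate (a j) (S j)) = (k : ENNReal)⁻¹ • m := by
  set T₀ := translate a₀ (subtorus Λ V₀) with hT₀
  have hfin := finite_setOrbit hAut hμ.invariant hmin hV₀ hd₀ hpos₀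
  have : Finite (setOrbit Γ T₀) := hfin.to_subtype
  obtain ⟨k, ⟨e⟩⟩ := Finite.exists_equiv_fin (setOrbit Γ T₀)
  choose a V hV hd hT using fun j => exists_eq_of_mem_setOrbit hAut hV₀ hd₀ (e.symm j).2
  have hmem : ∀ j, translate (a j) (subtorus Λ (V j)) ∈ setOrbit Γ T₀ := fun j =>
    hT j ▸ (e.symm j).2
  have hsurj : ∀ T ∈ setOrbit Γ T₀, ∃ j, T = translate (a j) (subtorus Λ (V j)) := fun T h =>
    ⟨e ⟨T, h⟩, by rw [← hT, Equiv.symm_apply_apply]⟩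
  have hinj : Function.Injective fun j => translate (a j) (subtorus Λ (V j)) := fun i j hij => by
    simp only [← hT] at hij
    exact e.symm.injective (Subtype.ext hij)
  have hperm : ∀ g ∈ Γ, ∀ i, ∃ j, g '' translate (a i) (subtorus Λ (V i)) =
      translate (a j) (subtorus Λ (V j)) := fun g hg i => by
    obtain ⟨f, hf, hfi⟩ := hmem i
    refine hsurj _ ⟨g * f, Γ.mul_mem hg hf, ?_⟩
    rw [← hfi, ← image_comp]
    rfl
  have hsub : ∀ g ∈ Γ, g '' (⋃ j, translate (a j) (subtorus Λ (V j))) ⊆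
      ⋃ j, translate (a j) (subtorus Λ (V j)) := fun g hg => by
    rw [image_iUnion]
    refine iUnion_subset fun i => ?_
    obtain ⟨j, hj⟩ := hperm g hg i
    rw [hj]
    exact subset_iUnion (fun j => translate (a j) (subtorus Λ (V j))) j
  have himage : ∀ g ∈ Γ, g '' (⋃ j, translate (a j) (subtorus Λ (V j))) =
      ⋃ j, translate (a j) (subtorus Λ (V j)) := fun g hg => by
    refine (hsub g hg).antisymm fun x hx => ?_
    exact ⟨_, hsub g⁻¹ (Γ.inv_mem hg) ⟨x, hx, rfl⟩, g.apply_symm_apply x⟩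
  have hpos : 0 < k := by
    have : T₀ ∈ setOrbit Γ T₀ := ⟨1, Γ.one_mem, image_id T₀⟩
    obtain ⟨j, -⟩ := hsurj _ this
    exact j.pos
  have hmeas : ∀ j, μ (translate (a j) (subtorus Λ (V j))) = μ T₀ := fun j => by
    obtain ⟨f, hf, hfj⟩ := hmem j
    rw [← hfj, measure_image_eq (hμ.invariant f hf)]
  have hclosed : ∀ j, IsClosed (translate (a j) (subtorus Λ (V j))) := fun j =>
    isClosed_translate (isClosed_subtorus (hV j)) _
  have hU : MeasurableSet (⋃ j, translate (a j) (subtorus Λ (V j))) :=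
    MeasurableSet.iUnion fun j => (hclosed j).measurableSet
  have hcompl : μ (⋃ j, translate (a j) (subtorus Λ (V j)))ᶜ = 0 := by
    refine (hμ.ergodic _ hU fun g hg => ?_).resolve_left fun h0 => ?_
    · conv_lhs => rw [← himage g hg]
      exact preimage_image_eq _ g.injective
    · exact hpos₀ ((hmeas ⟨0, hpos⟩).symm.trans (measure_mono_null
        (subset_iUnion (fun j => translate (a j) (subtorus Λ (V j))) ⟨0, hpos⟩) h0))
  -- The `k` pieces are almost disjoint, have equal mass and carry `μ`; so `k` times each
  -- restriction is a probability measure.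
  have hk : (k : ENNReal) * μ T₀ = 1 := by
    have h1 : μ (⋃ j, translate (a j) (subtorus Λ (V j))) = 1 :=
      (prob_compl_eq_zero_iff hU).1 hcompl
    rw [measure_iUnion₀ (fun i j hij => aedisjoint_translate hmin (hV i) (hd i) (hV j) (hd j)
      (hinj.ne hij)) fun j => (hclosed j).measurableSet.nullMeasurableSet] at h1
    simpa [hmeas] using h1
  have hk0 : (k : ENNReal) ≠ 0 := by exact_mod_cast hpos.ne'
  refine ⟨k, fun j => subtorus Λ (V j), a, hpos,
    fun j => ⟨isClosed_subtorus (hV j), V j, hd j, rfl⟩, hinj, himage, hperm, fun i j => ?_, hcompl,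
    fun j => ⟨(k : ENNReal) • μ.restrict (translate (a j) (subtorus Λ (V j))), ?_, ?_⟩⟩
  · obtain ⟨f, hf, hfi⟩ := hmem i
    obtain ⟨f', hf', hfj⟩ := hmem j
    refine ⟨f' * f⁻¹, Γ.mul_mem hf' (Γ.inv_mem hf), ?_⟩
    rw [← hfi, ← hfj, ← image_comp]
    change (f' * f⁻¹ * f : Torus Λ ≃ₜ Torus Λ) '' T₀ = _
    rw [inv_mul_cancel_right]
  · have : IsProbabilityMeasure
        ((k : ENNReal) • μ.restrict (translate (a j) (subtorus Λ (V j)))) :=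
      ⟨by rw [Measure.smul_apply, Measure.restrict_apply_univ, hmeas, smul_eq_mul, hk]⟩
    refine isHaarOnTranslate_of_map_add (isClosed_subtorus (hV j)) ?_ fun t ht => ?_
    · rw [Measure.smul_apply, Measure.restrict_apply (hclosed j).measurableSet.compl,
        compl_inter_self, measure_empty, smul_zero]
    · rw [Measure.map_smul, (exists_invariance hAut hμ.invariant hmin hΓ hpar (hV j) (hd j)
        (by rw [hmeas]; exact hpos₀)).2 t ht]
  · rw [smul_smul, ENNReal.inv_mul_cancel hk0 (ENNReal.natCast_ne_top k), one_smul]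

end Haar

end AbelianSurface

namespace AbelianSurface

/-! ## Elliptic curves as Riemann surfaces -/

section EllipticCurve

variable {L : Submodule ℤ ℂ}

variable (L) in
/-- The quotient of `ℂ` by a lattice. -/
abbrev Curve : Type := ℂ ⧸ L.toAddSubgroup

variable (L) in
/-- The projection onto the quotient of `ℂ` by a lattice. -/
def curveProj (t : ℂ) : Curve L := QuotientAddGroup.mk t

theorem curveProj_eq_iff {s t : ℂ} : curveProj L s = curveProj L t ↔ s - t ∈ L := by
  rw [curveProj, curveProj, eq_comm, QuotientAddGroup.eq, neg_add_eq_sub]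
  rfl

theorem continuous_curveProj : Continuous (curveProj L) := continuous_quotient_mk'

theorem curveProj_surjective : Function.Surjective (curveProj L) := QuotientAddGroup.mk_surjective

variable [DiscreteTopology L]

theorem isLocalHomeomorph_curveProj : IsLocalHomeomorph (curveProj L) :=
  (AddSubgroup.isAddQuotientCoveringMap L.toAddSubgroup
    (isDiscrete_iff_discreteTopology.2
      (inferInstanceAs (DiscreteTopology L)))).isCoveringMap.isLocalHomeomorph

instance isClosed_curve : IsClosed (L.toAddSubgroup : Set ℂ) :=
  haveI : DiscreteTopology L.toAddSubgroup := inferInstanceAs (DiscreteTopology L)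
  AddSubgroup.isClosed_of_discrete

instance [IsZLattice ℝ L] : CompactSpace (Curve L) where
  isCompact_univ := by
    have := IsZLattice.isCompact_range_of_periodic L (curveProj L) continuous_curveProj
      fun z w hw => curveProj_eq_iff.2 (by simpa using hw)
    rwa [curveProj_surjective.range_eq] at this

instance : ConnectedSpace (Curve L) :=
  curveProj_surjective.connectedSpace continuous_curveProj

theorem exists_chart (b : Curve L) : ∃ e : OpenPartialHomeomorph (Curve L) ℂ,
    b ∈ e.source ∧ ∀ c ∈ e.source, curveProj L (e c) = c := by
  obtain ⟨t, rfl⟩ := curveProj_surjective b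
  obtain ⟨e, ht, he⟩ := isLocalHomeomorph_curveProj (L := L) t
  refine ⟨e.symm, ?_, fun c hc => ?_⟩
  · rw [he]
    exact e.map_source ht
  · rw [he]
    exact e.right_inv hc

/-- The charts of the quotient are the local inverses of the projection. -/
noncomputable instance chartedSpaceCurve : ChartedSpace ℂ (Curve L) where
  atlas := {e | ∀ b ∈ e.source, curveProj L (e b) = b}
  chartAt b := (exists_chart b).choose
  mem_chart_source b := (exists_chart b).choose_spec.1
  chart_mem_atlas b := (exists_chart b).choose_spec.2

/-- The difference between the chart expression and `F` is continuous and lattice-valued. This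
serves both for the transition maps, which are local translations, and for holomorphy of the
projection. -/
theorem eventually_chart_eq {T : Type*} [TopologicalSpace T] {e : OpenPartialHomeomorph (Curve L) ℂ}
    (he : ∀ b ∈ e.source, curveProj L (e b) = b) {F : T → ℂ} {z : T} (hF : ContinuousAt F z)
    (hz : curveProj L (F z) ∈ e.source) :
    ∃ c, ∀ᶠ w in 𝓝 z, e (curveProj L (F w)) = F w + c := by
  have hcont : ContinuousAt (fun w => curveProj L (F w)) z :=
    continuous_curveProj.continuousAt.comp hF
  have hmem : ∀ᶠ w in 𝓝 z, e (curveProj L (F w)) - F w ∈ L := by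
    filter_upwards [hcont.eventually (e.open_source.mem_nhds hz)] with w hw
    exact curveProj_eq_iff.1 (he _ hw)
  have h2 := eventually_eq_of_eventually_mem
    (((e.continuousAt hz).comp (f := fun w => curveProj L (F w)) hcont).sub hF) hmem
  refine ⟨e (curveProj L (F z)) - F z, ?_⟩
  filter_upwards [h2] with w hw
  have hw' : e (curveProj L (F w)) - F w = e (curveProj L (F z)) - F z := hw
  rw [← hw']
  ring

instance : IsManifold 𝓘(ℂ) ω (Curve L) := by
  refine isManifold_of_contDiffOn _ _ _ fun e e' he he' => ?_
  intro x hx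
  simp only [modelWithCornersSelf_coe, modelWithCornersSelf_coe_symm, Function.id_comp,
    Function.comp_id, preimage_id, range_id, inter_univ] at hx ⊢
  have hinv : ∀ w ∈ e.target, e.symm w = curveProj L w := fun w hw => by
    have := he (e.symm w) (e.map_target hw)
    rw [e.right_inv hw] at this
    exact this.symm
  rw [OpenPartialHomeomorph.trans_source, OpenPartialHomeomorph.symm_source] at hx
  have hx2 : curveProj L x ∈ e'.source := hinv x hx.1 ▸ hx.2
  obtain ⟨c, hc⟩ := eventually_chart_eq he' (F := fun w : ℂ => w) continuousAt_id hx2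
  refine ContDiffAt.contDiffWithinAt ?_
  have : (e.symm ≫ₕ e' : ℂ → ℂ) =ᶠ[𝓝 x] fun w => w + c := by
    filter_upwards [hc, e.open_target.mem_nhds hx.1] with w h1 h2
    rw [OpenPartialHomeomorph.coe_trans, Function.comp_apply, hinv w h2, h1]
  exact (contDiffAt_id.add contDiffAt_const).congr_of_eventuallyEq this

theorem mdifferentiable_curveProj_comp {l : (ℂ × ℂ) →ₗ[ℂ] ℂ} :
    MDifferentiable 𝓘(ℂ, ℂ × ℂ) 𝓘(ℂ) fun z : ℂ × ℂ => curveProj L (l z) := by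
  intro z
  have hl : Continuous l := LinearMap.continuous_of_finiteDimensional l
  rw [mdifferentiableAt_iff_target]
  refine ⟨(continuous_curveProj.comp hl).continuousAt, ?_⟩
  rw [mdifferentiableAt_iff_differentiableAt]
  obtain ⟨c, hc⟩ := eventually_chart_eq (chart_mem_atlas ℂ (curveProj L (l z))) hl.continuousAt
    (mem_chart_source ℂ (curveProj L (l z)))
  refine DifferentiableAt.congr_of_eventuallyEq (f := fun w => l w + c) ?_ ?_
  · exact ((LinearMap.toContinuousLinearMap l).differentiableAt).add_const c
  · filter_upwards [hc] with w hw
    simpa using hw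

end EllipticCurve

/-! ## The fibration invariant under a parabolic automorphism -/

section Fibration

variable {Λ : Submodule ℤ (ℂ × ℂ)}

/-- A nilpotent endomorphism of rank one preserving the lattice, written `z ↦ l z • e`. -/
structure IsRankOne (Λ : Submodule ℤ (ℂ × ℂ)) (l : (ℂ × ℂ) →ₗ[ℂ] ℂ) (e : ℂ × ℂ) : Prop where
  map_mem : ∀ z ∈ Λ, l z • e ∈ Λ
  surjective : Function.Surjective l
  ne_zero : e ≠ 0
  apply_eq_zero_iff : ∀ z, l z = 0 ↔ ∃ t : ℂ, z = t • e

variable {l : (ℂ × ℂ) →ₗ[ℂ] ℂ} {e : ℂ × ℂ}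

variable (Λ l) in
/-- The image of the lattice under a linear form. -/
def imageLattice : Submodule ℤ ℂ := Λ.map (l.restrictScalars ℤ)

variable (Λ e) in
/-- The intersection of the lattice with a line. -/
def lineLattice : Submodule ℤ ℂ :=
  Λ.comap ((LinearMap.toSpanSingleton ℂ (ℂ × ℂ) e).restrictScalars ℤ)

theorem mem_lineLattice {t : ℂ} : t ∈ lineLattice Λ e ↔ t • e ∈ Λ := Iff.rfl

/-- Through this inclusion, discreteness passes from the line lattice to the image lattice, and full
rank passes the other way. -/
theorem IsRankOne.imageLattice_le (h : IsRankOne Λ l e) : imageLattice Λ l ≤ lineLattice Λ e := by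
  rintro _ ⟨z, hz, rfl⟩
  exact h.map_mem z hz

theorem IsRankOne.discreteTopology_lineLattice [DiscreteTopology Λ] (h : IsRankOne Λ l e) :
    DiscreteTopology (lineLattice Λ e) :=
  DiscreteTopology.preimage_of_continuous_injective (Λ : Set (ℂ × ℂ))
    (f := fun t : ℂ => t • e) (by fun_prop) (smul_left_injective ℂ h.ne_zero)

theorem IsRankOne.discreteTopology_imageLattice [DiscreteTopology Λ] (h : IsRankOne Λ l e) :
    DiscreteTopology (imageLattice Λ l) :=
  have := h.discreteTopology_lineLattice
  DiscreteTopology.of_subset this h.imageLattice_le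

theorem IsRankOne.isZLattice_imageLattice [DiscreteTopology Λ] [IsZLattice ℝ Λ]
    [DiscreteTopology (imageLattice Λ l)] (h : IsRankOne Λ l e) : IsZLattice ℝ (imageLattice Λ l) where
  span_top := by
    have h1 : (imageLattice Λ l : Set ℂ) = l.restrictScalars ℝ '' (Λ : Set (ℂ × ℂ)) := rfl
    rw [h1, Submodule.span_image, IsZLattice.span_top, Submodule.map_top]
    exact LinearMap.range_eq_top.2 h.surjective

theorem IsRankOne.isZLattice_lineLattice [DiscreteTopology Λ] [IsZLattice ℝ Λ]
    [DiscreteTopology (lineLattice Λ e)] (h : IsRankOne Λ l e) : IsZLattice ℝ (lineLattice Λ e) where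
  span_top := by
    have := h.discreteTopology_imageLattice
    have := h.isZLattice_imageLattice.span_top
    exact top_le_iff.1 (this ▸ Submodule.span_mono h.imageLattice_le)

variable (Λ l) in
/-- The projection of the torus onto an elliptic curve induced by a linear form. -/
def fibration : Torus Λ → Curve (imageLattice Λ l) :=
  QuotientAddGroup.map Λ.toAddSubgroup (imageLattice Λ l).toAddSubgroup l.toAddMonoidHom
    fun z hz => ⟨z, hz, rfl⟩

theorem fibration_proj (z : ℂ × ℂ) :
    fibration Λ l (proj Λ z) = curveProj (imageLattice Λ l) (l z) := rfl

theorem IsRankOne.fibration_eq_iff (h : IsRankOne Λ l e) {z w : ℂ × ℂ} :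
    fibration Λ l (proj Λ z) = fibration Λ l (proj Λ w) ↔
      ∃ t : ℂ, proj Λ z = proj Λ (w + t • e) := by
  rw [fibration_proj, fibration_proj, curveProj_eq_iff]
  constructor
  · rintro ⟨v, hv, hvz⟩
    have h1 : l (z - w - v) = 0 := by
      rw [map_sub, map_sub, ← hvz]
      exact sub_self _
    obtain ⟨t, ht⟩ := (h.apply_eq_zero_iff _).1 h1
    refine ⟨t, proj_eq_iff.2 ?_⟩
    rw [← ht, show z - (w + (z - w - v)) = v by abel]
    exact hv
  · rintro ⟨t, ht⟩
    refine ⟨_, proj_eq_iff.1 ht, ?_⟩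
    have h1 : l (t • e) = 0 := (h.apply_eq_zero_iff _).2 ⟨t, rfl⟩
    change l (z - (w + t • e)) = l z - l w
    rw [map_sub, map_add, h1, add_zero]

theorem IsRankOne.fiber_eq (h : IsRankOne Λ l e) (z : ℂ × ℂ) :
    fibration Λ l ⁻¹' {fibration Λ l (proj Λ z)} = range fun t : ℂ => proj Λ (z + t • e) := by
  ext x
  obtain ⟨w, rfl⟩ := proj_surjective x
  rw [mem_preimage, mem_singleton_iff, h.fibration_eq_iff]
  exact exists_congr fun t => eq_comm

theorem IsRankOne.fibration_surjective (h : IsRankOne Λ l e) :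
    Function.Surjective (fibration Λ l) := by
  intro b
  obtain ⟨t, rfl⟩ := curveProj_surjective b
  obtain ⟨z, rfl⟩ := h.surjective t
  exact ⟨proj Λ z, rfl⟩

/-- Every fiber is a translate of the image of the line `ℂ e`, uniformized by the lattice
`lineLattice Λ e`, so there is no exceptional fiber. -/
theorem IsRankOne.isGenusOneFibration [DiscreteTopology Λ] [IsZLattice ℝ Λ]
    (h : IsRankOne Λ l e) :
    have := h.discreteTopology_imageLattice
    IsGenusOneFibration (fibration Λ l) := by
  have := h.discreteTopology_imageLattice
  have hfib : ∀ b, ∃ z, fibration Λ l ⁻¹' {b} = range fun t : ℂ => proj Λ (z + t • e) := by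
    intro b
    obtain ⟨x, rfl⟩ := h.fibration_surjective b
    obtain ⟨z, rfl⟩ := proj_surjective x
    exact ⟨z, h.fiber_eq z⟩
  refine ⟨mdifferentiable_curveProj_comp, h.fibration_surjective, fun b => ?_,
    ∅, finite_empty, fun b _ => ?_⟩
  · obtain ⟨z, hz⟩ := hfib b
    rw [hz]
    exact isConnected_range (continuous_proj.comp (by fun_prop))
  · obtain ⟨z, hz⟩ := hfib b
    have hline := h.discreteTopology_lineLattice
    refine ⟨lineLattice Λ e, hline, h.isZLattice_lineLattice,
      fun t => proj Λ (z + t • e), fun t => ⟨fun s => z + s • e, ?_, ?_, ?_⟩, fun s t => ?_, hz.symm⟩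
    · fun_prop
    · have : HasDerivAt (fun s : ℂ => z + s • e) ((1 : ℂ) • e) t :=
        ((hasDerivAt_id t).smul_const e).const_add z
      rw [this.deriv, one_smul]
      exact h.ne_zero
    · exact Eventually.of_forall fun _ => rfl
    · rw [proj_eq_iff, add_sub_add_left_eq_sub, ← sub_smul, mem_lineLattice]

theorem exists_isRankOne {N : Module.End ℂ (ℂ × ℂ)} (hN : N * N = 0) (h0 : N ≠ 0)
    (hΛ : ∀ v ∈ Λ, N v ∈ Λ) : ∃ l e, IsRankOne Λ l e ∧ ∀ z, N z = l z • e := by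
  obtain ⟨b, hb0, hb1⟩ := exists_basis_of_sq_eq_zero hN h0
  have hNz : ∀ z, N z = b.coord 0 z • b 1 := fun z => by
    conv_lhs => rw [← b.sum_repr z, Fin.sum_univ_two]
    rw [map_add, map_smul, map_smul, hb0, hb1, smul_zero, add_zero]
    rfl
  refine ⟨b.coord 0, b 1, ⟨fun z hz => hNz z ▸ hΛ z hz, fun t => ⟨t • b 0, by simp⟩, b.ne_zero 1,
    fun z => ⟨fun hz => ⟨b.repr z 1, ?_⟩, ?_⟩⟩, hNz⟩
  · conv_lhs => rw [← b.sum_repr z, Fin.sum_univ_two]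
    rw [show b.repr z 0 = 0 from hz, zero_smul, zero_add]
  · rintro ⟨t, rfl⟩
    simp

/-- A parabolic automorphism acting with infinite order on the base of its invariant fibration has
no periodic point. -/
theorem not_periodic_of_actsWithInfiniteOrderOnBase [DiscreteTopology Λ] [IsZLattice ℝ Λ]
    {g : Torus Λ ≃ₜ Torus Λ} (hg : g ∈ Aut Λ) (hpar : IsParabolic g)
    (hbase : ActsWithInfiniteOrderOnBase g) {n : ℕ} (hn : 1 ≤ n) (x : Torus Λ) :
    (g ^ n : Torus Λ ≃ₜ Torus Λ) x ≠ x := by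
  intro hx
  obtain ⟨b, hb⟩ := exists_isAffine_linearPart ⟨g, hg⟩
  obtain ⟨k, N, hk, hA, hN, hN0⟩ := hpar.exists_unipotent hb (linearPart_surjective _)
  set A := linearPart Λ ⟨g, hg⟩
  obtain ⟨c, hc⟩ := hb.pow k
  rw [hA] at hc
  have hNΛ : ∀ v ∈ Λ, N v ∈ Λ := fun v hv => by
    have := Λ.sub_mem (hc.map_mem hv) hv
    simpa using this
  obtain ⟨l, e, h, hNl⟩ := exists_isRankOne hN hN0 hNΛ
  -- `A` commutes with its power `1 + N`, hence preserves the kernel `ℂ e` of `N`; so `g` permutes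
  -- the fibers.
  have hcomm : ∀ z, N (A z) = A (N z) := fun z => by
    have h1 : Commute (1 + N) A := hA ▸ (Commute.refl A).pow_left k
    have h2 : Commute N A := by
      have := h1.sub_left (Commute.one_left A)
      rwa [add_sub_cancel_left] at this
    exact congrArg (fun l => l z) h2.eq
  have hle : ∀ t : ℂ, l (t • e) = 0 := fun t => (h.apply_eq_zero_iff _).2 ⟨t, rfl⟩
  have hlA : l (A e) = 0 := by
    obtain ⟨u, hu⟩ := h.surjective 1
    have h1 : e = N u := by rw [hNl, hu, one_smul]
    have h2 : N (A e) = 0 := by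
      rw [hcomm, h1]
      have : N (N u) = 0 := congrArg (fun l => l u) hN
      rw [this, map_zero]
    rw [hNl] at h2
    exact (smul_eq_zero.1 h2).resolve_right h.ne_zero
  have hwell : ∀ x y, fibration Λ l x = fibration Λ l y →
      fibration Λ l (g x) = fibration Λ l (g y) := by
    intro x y hxy
    obtain ⟨z, rfl⟩ := proj_surjective x
    obtain ⟨w, rfl⟩ := proj_surjective y
    obtain ⟨t, ht⟩ := h.fibration_eq_iff.1 hxy
    have hb' : ∀ z, g (proj Λ z) = proj Λ (A z + b) := hb
    rw [ht, hb', hb', fibration_proj, fibration_proj]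
    simp only [map_add, map_smul, hlA, smul_zero, add_zero]
  have := h.discreteTopology_imageLattice
  have := h.isZLattice_imageLattice
  let gB : Curve (imageLattice Λ l) → Curve (imageLattice Λ l) := fun y =>
    fibration Λ l (g (Function.surjInv h.fibration_surjective y))
  have hgB : ∀ x, fibration Λ l (g x) = gB (fibration Λ l x) := fun x =>
    hwell _ _ (Function.surjInv_eq h.fibration_surjective _).symm
  have hiter : ∀ m x, gB^[m] (fibration Λ l x) =
      fibration Λ l ((g ^ m : Torus Λ ≃ₜ Torus Λ) x) := by
    intro m
    induction m with
    | zero => intro x; rfl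
    | succ m ih => intro x; rw [Function.iterate_succ_apply, ← hgB, ih, pow_succ]; rfl
  refine hbase (Curve (imageLattice Λ l)) (fibration Λ l) gB h.isGenusOneFibration hgB (k * n)
    (Nat.mul_pos hk hn) (funext fun y => ?_)
  obtain ⟨y, rfl⟩ := h.fibration_surjective y
  obtain ⟨w, rfl⟩ := proj_surjective y
  obtain ⟨z, rfl⟩ := proj_surjective x
  obtain ⟨d, hd⟩ := hb.pow (k * n)
  -- Since `l` kills the range of `N`, the iterate of order `k * n` acts on the base as the
  -- translation by `l d`; the periodic point forces `l d` into the image lattice.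
  have hlpow : ∀ u, l ((A ^ (k * n)) u) = l u := fun u => by
    rw [pow_mul, hA]
    have hstep : ∀ v, l ((1 + N) v) = l v := fun v => by
      rw [LinearMap.add_apply, Module.End.one_apply, map_add, hNl, hle, add_zero]
    clear hx hn hd
    induction n with
    | zero => rfl
    | succ n ih => rw [pow_succ', Module.End.mul_apply, hstep, ih]
  have hfix : (g ^ (k * n) : Torus Λ ≃ₜ Torus Λ) (proj Λ z) = proj Λ z := by
    have : ∀ m : ℕ, ((g ^ n) ^ m : Torus Λ ≃ₜ Torus Λ) (proj Λ z) = proj Λ z := by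
      intro m
      induction m with
      | zero => rfl
      | succ m ih =>
        rw [pow_succ]
        change ((g ^ n) ^ m : Torus Λ ≃ₜ Torus Λ) ((g ^ n : Torus Λ ≃ₜ Torus Λ) (proj Λ z)) = _
        rw [hx, ih]
    rw [mul_comm, pow_mul, this]
  have hdw : fibration Λ l ((g ^ (k * n) : Torus Λ ≃ₜ Torus Λ) (proj Λ w)) =
    fibration Λ l (proj Λ ((A ^ (k * n)) w + d)) := congrArg (fibration Λ l) (hd w)
  have h1 : fibration Λ l (proj Λ z) = fibration Λ l (proj Λ ((A ^ (k * n)) z + d)) :=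
    (congrArg (fibration Λ l) hfix).symm.trans (congrArg (fibration Λ l) (hd z))
  rw [fibration_proj, fibration_proj, curveProj_eq_iff, map_add, hlpow, sub_add_cancel_left] at h1
  rw [hiter, hdw, id, fibration_proj, fibration_proj, curveProj_eq_iff, map_add, hlpow,
    add_sub_cancel_left]
  exact (Submodule.neg_mem_iff _).1 h1

end Fibration

end AbelianSurface

/-! ### Conclusion: the possible dimensions 0, 2 and 4 -/

theorem mainTheorem12 (Λ : Submodule ℤ (ℂ × ℂ)) [DiscreteTopology Λ] [IsZLattice ℝ Λ]
    (hΛ : AbelianSurface.IsAbelian Λ)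
    (Γ : Subgroup (AbelianSurface.Torus Λ ≃ₜ AbelianSurface.Torus Λ))
    (hAut : Γ ≤ AbelianSurface.Aut Λ)
    (hΓ : AbelianSurface.IsNonElementary Γ)
    (hpar : ∃ g ∈ Γ, AbelianSurface.IsParabolic g)
    (hbase : ∀ g ∈ Γ, AbelianSurface.IsParabolic g →
      AbelianSurface.ActsWithInfiniteOrderOnBase g)
    (μ : MeasureTheory.Measure (AbelianSurface.Torus Λ)) [MeasureTheory.IsProbabilityMeasure μ]
    (hμ : AbelianSurface.IsInvariantErgodic Γ μ) :
    μ.IsAddHaarMeasure ∨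
    ∃ (k : ℕ) (S : Fin k → AddSubgroup (AbelianSurface.Torus Λ))
      (a : Fin k → AbelianSurface.Torus Λ),
      0 < k ∧
      (∀ j, AbelianSurface.IsRealSubtorus 2 (S j)) ∧
      Function.Injective (fun j => AbelianSurface.translate (a j) (S j)) ∧
      (∀ g ∈ Γ, g '' (⋃ j, AbelianSurface.translate (a j) (S j)) =
        ⋃ j, AbelianSurface.translate (a j) (S j)) ∧
      (∀ g ∈ Γ, ∀ i, ∃ j, g '' AbelianSurface.translate (a i) (S i) =
        AbelianSurface.translate (a j) (S j)) ∧
      (∀ i j, ∃ g ∈ Γ, g '' AbelianSurface.translate (a i) (S i) =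
        AbelianSurface.translate (a j) (S j)) ∧
      μ (⋃ j, AbelianSurface.translate (a j) (S j))ᶜ = 0 ∧
      ∀ j, ∃ m : MeasureTheory.Measure (AbelianSurface.Torus Λ),
        AbelianSurface.IsHaarOnTranslate (a j) (S j) m ∧
        μ.restrict (AbelianSurface.translate (a j) (S j)) = (k : ENNReal)⁻¹ • m := by
  obtain ⟨d, V, a, hmin, hV, hd, hpos⟩ := AbelianSurface.exists_minimal_translate (μ := μ)
  obtain ⟨heven, hinv⟩ :=
    AbelianSurface.exists_invariance hAut hμ.invariant hmin hΓ hpar hV hd hpos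
  have h4 : Module.finrank ℝ (ℂ × ℂ) = 4 := by
    rw [Module.finrank_prod, Complex.finrank_real_complex]
  have hle : d ≤ 4 := by
    rw [← hd, ← h4]
    exact Submodule.finrank_le V
  have hcases : d = 0 ∨ d = 2 ∨ d = 4 := by
    obtain ⟨r, rfl⟩ := heven
    omega
  rcases hcases with rfl | rfl | rfl
  -- In dimension 0 the charged translate is an atom with finite orbit, hence a periodic point of
  -- the parabolic element.
  · exfalso
    obtain ⟨g, hg, hgpar⟩ := hpar
    obtain ⟨n, hn, hfix⟩ :=
      AbelianSurface.exists_pow_image_eq hAut hμ.invariant hmin hV hd hpos hg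
    rw [Submodule.finrank_eq_zero.1 hd, AbelianSurface.translate_subtorus_bot, image_singleton,
      singleton_eq_singleton_iff] at hfix
    exact AbelianSurface.not_periodic_of_actsWithInfiniteOrderOnBase (hAut hg) hgpar
      (hbase g hg hgpar) hn a hfix
  · exact Or.inr (AbelianSurface.exists_translates hAut hΓ hpar hμ hmin hV hd hpos)
  · left
    have htop : V = ⊤ := Submodule.eq_top_of_finrank_eq (hd.trans h4.symm)
    subst htop
    refine AbelianSurface.isAddHaarMeasure_of_map_add fun t => ?_
    obtain ⟨z, rfl⟩ := AbelianSurface.proj_surjective t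
    have := hinv _ (AbelianSurface.proj_mem_subtorus (v := z) trivial)
    rwa [AbelianSurface.translate_subtorus_top, Measure.restrict_univ] at this
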